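/- Let $M$ be a $W^*$-algebra, let $n\ge 2$, and let $\{X_s\}_{s\in\mathbb{Z}_+^n}$ be a product system of $W^*$-correspondences over $M$: every $X_s$ is a self-dual Hilbert $M$-module with a unital normal left action, $X_0=M$, and there are isomorphisms of correspondences $X_s\otimes X_t\cong X_{s+t}$ forming an associative unital multiplication. Write $E_i=X_{\mathbf e_i}$ and $E_{1n}=E_1\otimes E_n$; tensor products of the $X_s$ are identified with each other through the multiplication (so $E_i\otimes E_j=E_j\otimes E_i$). For a correspondence $E$, $E\otimes K$ denotes the interior tensor product with a Hilbert space $K$ carrying a normal unital representation of $M$, and $M$ acts on it by $\varphi_E(a)\otimes I_K$. Let $(\sigma,T_1,\dots,T_n)$ be a completely contractive representation of the product system on a Hilbert space $H$: $\sigma$ is a normal representation of $M$, each $T_i:E_i\to B(H)$ is a completely contractive bimodule map over $\sigma$, and the contractions $\tilde T_i:E_i\otimes H\to H$, $\tilde T_i(\xi\otimes h)=T_i(\xi)h$, satisfy $\tilde T_i(I_{E_i}\otimes\tilde T_j)=\tilde T_j(I_{E_j}\otimes\tilde T_i)$ for all $i,j$. For $G=\{i_1<\dots<i_k\}$ put $\tilde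 T_G=\tilde T_{i_1}(I\otimes\tilde T_{i_2})\cdots(I\otimes \tilde T_{i_k})$. Assume that $$D_{\hat T_1}^2:=\sum_{G\subseteq\{2,\dots,n\}}(-1)^{|G|}\tilde T_G\tilde T_G^*\ge 0,\qquad D_{\hat T_n}^2:=\sum_{G\subseteq\{1,\dots,n-1\}}(-1)^{|G|}\tilde T_G\tilde T_G^*\ge 0,$$ and that for $1\le i\le n-1$, $\tilde T_i^{(k)}\tilde T_i^{(k)*}\to 0$ in the weak operator topology as $k\to\infty$, where $\tilde T_i^{(k)}=\tilde T_i(I\otimes\tilde T_i)\cdots(I\otimes\tilde T_i)$ ($k$ factors). Let $D_{\hat T_1},D_{\hat T_n}$ be the positive square roots and $\mathcal D_{\hat T_1},\mathcal D_{\hat T_n}$ the closures of their ranges, with the restrictions of $\sigma$. Let $\mathcal E_1,\mathcal E_2$ be Hilbert spaces with normal representations of $M$, let $u_2:\mathcal E_2\to E_n\otimes\mathcal E_1$ be a unitary that intertwines the representations of $M$, put $$\mathcal D=\mathcal D_{\hat T_n}\oplus(E_1\otimes\mathcal D_{\hat T_1})\oplus\mathcal E_1,\qquad \mathcal D'=\mathcal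 D_{\hat T_n}\oplus\mathcal E_1,$$ and let $U:\mathcal D_{\hat T_1}\oplus(E_n\otimes\mathcal D_{\hat T_n})\oplus\mathcal E_2\to\mathcal D$ be a unitary that intertwines the representations of $M$ and satisfies, for all $h\in H$, $$U\big(D_{\hat T_1}h\oplus(I_{E_n}\otimes D_{\hat T_n})\tilde T_n^*h\oplus 0\big)=D_{\hat T_n}h\oplus(I_{E_1}\otimes D_{\hat T_1})\tilde T_1^*h\oplus 0 .$$ Let $P_1:\mathcal D\to E_1\otimes\mathcal D_{\hat T_1}$ be the projection and $i_2:\mathcal D'\to\mathcal D$ the inclusion. Let $j_2'$ map $E_{1n}\otimes\mathcal D'=(E_1\otimes E_n\otimes\mathcal D_{\hat T_n})\oplus(E_1\otimes E_n\otimes\mathcal E_1)$ into $E_1\otimes(\mathcal D_{\hat T_1}\oplus(E_n\otimes\mathcal D_{\hat T_n})\oplus\mathcal E_2)$ by $I\oplus(I_{E_1}\otimes u_2^*)$ followed by the inclusion. Let $P_2$ be the projection of $\mathcal D_{\hat T_1}\oplus(E_n\otimes\mathcal D_{\hat T_n})\oplus\mathcal E_2$ onto $(E_n\otimes\mathcal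 D_{\hat T_n})\oplus\mathcal E_2$, let $i_1$ be the inclusion of $\mathcal D_{\hat T_1}$ into the same space, and let $i_1':E_{1n}\otimes\mathcal D_{\hat T_1}=E_n\otimes E_1\otimes\mathcal D_{\hat T_1}\to E_n\otimes\mathcal D$ be the inclusion. Define $$U_1=\begin{pmatrix}(I_{E_1}\otimes U)P_1&(I_{E_1}\otimes U)j_2'\\ i_2^*&0\end{pmatrix}:\mathcal D\oplus(E_{1n}\otimes\mathcal D')\to(E_1\otimes\mathcal D)\oplus\mathcal D',$$ $$U_n=\begin{pmatrix}(I\oplus u_2)P_2U^*& i_1'\\ i_1^*U^*&0\end{pmatrix}:\mathcal D\oplus(E_{1n}\otimes\mathcal D_{\hat T_1})\to(E_n\otimes\mathcal D)\oplus\mathcal D_{\hat T_1}.$$ Let $\mathcal F(E)\otimes\mathcal D=\bigoplus_{\alpha\in\mathbb Z_+^{n-1}}E^\alpha\otimes\mathcal D$ with $E^\alpha=E_{1n}^{\otimes\alpha_1}\otimes E_2^{\otimes\alpha_2}\otimes\cdots\otimes E_{n-1}^{\otimes\alpha_{n-1}}$. For $i\in\{1,n\}$ write $U_i=\begin{pmatrix}A&B\\C&0\end{pmatrix}$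 and define $$\tau_{U_i^*}=I_{\mathcal F(E)}\otimes\big(A^*+(I_{E_{1n}}\otimes C^*)B^*\big):E_i\otimes\mathcal F(E)\otimes\mathcal D=\mathcal F(E)\otimes E_i\otimes\mathcal D\to\mathcal F(E)\otimes\mathcal D,$$ where $\mathcal F(E)\otimes E_{1n}\otimes\mathcal D$ is regarded as a subspace of $\mathcal F(E)\otimes\mathcal D$ through $E^\alpha\otimes E_{1n}=E^{\alpha+\mathbf e_1}$. Let $\tilde L_1:E_{1n}\otimes\mathcal F(E)\otimes\mathcal D\to\mathcal F(E)\otimes\mathcal D$, $\tilde L_1(\xi\otimes k)=\xi\otimes k$, be the left creation operator. Then $$\tau_{U_1^*}\,(I_{E_1}\otimes\tau_{U_n^*})=\tilde L_1$$ on $E_1\otimes E_n\otimes\mathcal F(E)\otimes\mathcal D=E_{1n}\otimes\mathcal F(E)\otimes\mathcal D$. -/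

import Mathlib

universe u v w w₁ w₂

open scoped ComplexOrder TensorProduct

noncomputable section

namespace CorrDil

/-- `f` preserves suprema of (nonempty) upward directed sets of self-adjoint elements. In a
W*-algebra such a set has a supremum as soon as it is bounded above. -/
def PreservesSups {M : Type u} [CStarAlgebra M] [PartialOrder M] {N : Type*} [Preorder N]
    (f : M → N) : Prop :=
  ∀ S : Set M, S.Nonempty → DirectedOn (· ≤ ·) S → (∀ a ∈ S, IsSelfAdjoint a) →
    ∀ s : M, IsLUB S s → IsLUB (f '' S) (f s)

/-- A positive normal functional on `M`. -/
def IsNormalFunctional {M : Type u} [CStarAlgebra M] [PartialOrder M] (ω : M →L[ℂ] ℂ) : Prop :=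
  (∀ a : M, 0 ≤ a → 0 ≤ ω a) ∧ PreservesSups (fun a => (ω a).re)

/-- A W*-correspondence over `M`: a self-dual right Hilbert `M`-module, with inner product `ip`
linear in the second variable, with a left action of `M` through a unital normal
`*`-homomorphism into the adjointable operators. -/
structure WStarCorr (M : Type u) [CStarAlgebra M] [PartialOrder M] [StarOrderedRing M] where
  carrier : Type v
  [normedAddCommGroup : NormedAddCommGroup carrier]
  [normedSpace : NormedSpace ℂ carrier]
  [completeSpace : CompleteSpace carrier]
  [leftModule : Module M carrier]
  [rightModule : Module Mᵐᵒᵖ carrier]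
  [leftTower : IsScalarTower ℂ M carrier]
  [bimodule : SMulCommClass M Mᵐᵒᵖ carrier]
  ip : carrier → carrier → M
  ip_add_right : ∀ ξ η ζ, ip ξ (η + ζ) = ip ξ η + ip ξ ζ
  ip_smul_right : ∀ (c : ℂ) ξ η, ip ξ (c • η) = c • ip ξ η
  ip_op_smul_right : ∀ (a : M) ξ η, ip ξ (MulOpposite.op a • η) = ip ξ η * a
  star_ip : ∀ ξ η, star (ip ξ η) = ip η ξ
  ip_self_nonneg : ∀ ξ, 0 ≤ ip ξ ξ
  norm_sq : ∀ ξ, ‖ξ‖ ^ 2 = ‖ip ξ ξ‖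
  self_dual : ∀ f : carrier →L[ℂ] M, (∀ (a : M) ξ, f (MulOpposite.op a • ξ) = f ξ * a) →
    ∃ η, ∀ ξ, f ξ = ip η ξ
  left_adjoint : ∀ (a : M) ξ η, ip (a • ξ) η = ip ξ (star a • η)
  left_normal : ∀ ξ, PreservesSups (fun a : M => ip ξ (a • ξ))

attribute [instance] WStarCorr.normedAddCommGroup WStarCorr.normedSpace WStarCorr.completeSpace
  WStarCorr.leftModule WStarCorr.rightModule WStarCorr.leftTower WStarCorr.bimodule

/-- A Hilbert space with a (unital) `*`-representation of `M`. -/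
structure HRep (M : Type u) [CStarAlgebra M] where
  space : Type w
  [normedAddCommGroup : NormedAddCommGroup space]
  [innerProductSpace : InnerProductSpace ℂ space]
  [completeSpace : CompleteSpace space]
  rep : M →⋆ₐ[ℂ] (space →L[ℂ] space)

attribute [instance] HRep.normedAddCommGroup HRep.innerProductSpace HRep.completeSpace

section Basic

variable {M : Type u} [CStarAlgebra M]

/-- The representation is normal. -/
def HRep.IsNormal [PartialOrder M] (R : HRep.{u, w} M) : Prop :=
  ∀ h : R.space, PreservesSups (fun a : M => (inner ℂ h (R.rep a h)).re)

/-- Bounded operators intertwining two representations of `M`. -/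
@[ext]
structure Hom (R : HRep.{u, w₁} M) (S : HRep.{u, w₂} M) where
  op : R.space →L[ℂ] S.space
  comm : ∀ (a : M) (x : R.space), op (R.rep a x) = S.rep a (op x)

theorem HRep.inner_rep_left (R : HRep.{u, w} M) (a : M) (x y : R.space) :
    inner ℂ (R.rep a x) y = inner ℂ x (R.rep (star a) y) := by
  rw [map_star, ContinuousLinearMap.star_eq_adjoint, ContinuousLinearMap.adjoint_inner_right]

theorem HRep.rep_star_rep (R : HRep.{u, w} M) (a b : M) (x y : R.space) :
    inner ℂ (R.rep a x) (R.rep b y) = inner ℂ x (R.rep (star a * b) y) := by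
  rw [R.inner_rep_left, map_mul]; rfl

theorem HRep.sum_inner_sum (R : HRep.{u, w} M) {k : ℕ} (B : Matrix (Fin k) (Fin k) M)
    (h h' : Fin k → R.space) :
    ∑ l, inner ℂ (∑ i, R.rep (B l i) (h i)) (∑ j, R.rep (B l j) (h' j)) =
      ∑ i, ∑ j, inner ℂ (h i) (R.rep (∑ l, star (B l i) * B l j) (h' j)) := by
  simp only [map_sum, sum_apply, inner_sum, sum_inner, R.rep_star_rep]
  rw [Finset.sum_comm]
  refine (Finset.sum_congr rfl fun j _ => Finset.sum_comm).trans ?_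
  exact Finset.sum_comm

end Basic

/-- A criterion for positivity in a C*-algebra: `G = G*` is of the form `B* B` as soon as the only
compression `P G P` (with `P = P*`) of the form `-C* C` is `0`. -/
theorem exists_factor_of_compression {A : Type*} [CStarAlgebra A] (G : A) (hsa : star G = G)
    (h : ∀ P C : A, star P = P → P * G * P = -(star C * C) → P * G * P = 0) :
    ∃ B : A, G = star B * B := by
  let _ := CStarAlgebra.spectralOrder A
  let _ := CStarAlgebra.spectralOrderedRing A
  have hsa : IsSelfAdjoint G := hsa
  have hn : 0 ≤ G⁻ := CFC.negPart_nonneg G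
  have hs : star G⁻ = G⁻ := (IsSelfAdjoint.of_nonneg hn).star_eq
  have h1 : G⁻ * G * G⁻ = -(G⁻ * G⁻ * G⁻) := by
    nth_rw 2 [← CFC.posPart_sub_negPart G hsa]
    rw [mul_sub, CFC.negPart_mul_posPart, zero_sub, neg_mul]
  have h3 : 0 ≤ G⁻ * G⁻ * G⁻ := by
    have := star_left_conjugate_nonneg hn G⁻
    rwa [hs] at this
  obtain ⟨C, hC⟩ := CStarAlgebra.nonneg_iff_eq_star_mul_self.mp h3
  have h8 : G⁻ * G⁻ * G⁻ = 0 := by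
    rw [← neg_eq_zero, ← h1]
    exact h _ C hs (by rw [h1, hC])
  have h9 : G⁻ * G⁻ = 0 := by
    have : star (G⁻ * G⁻) * (G⁻ * G⁻) = 0 := by
      rw [star_mul, hs, ← mul_assoc, h8, zero_mul]
    exact CStarRing.star_mul_self_eq_zero_iff _ |>.mp this
  have h10 : G⁻ = 0 := by
    have : star G⁻ * G⁻ = 0 := by rw [hs, h9]
    exact CStarRing.star_mul_self_eq_zero_iff _ |>.mp this
  exact CStarAlgebra.nonneg_iff_eq_star_mul_self.mp ((CFC.negPart_eq_zero_iff G hsa).mp h10)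

section Gram

variable {M : Type u} [CStarAlgebra M] [PartialOrder M] [StarOrderedRing M]

namespace WStarCorr

variable (E : WStarCorr.{u, v} M)

theorem ip_add_left (ξ η ζ : E.carrier) : E.ip (ξ + η) ζ = E.ip ξ ζ + E.ip η ζ := by
  rw [← E.star_ip, E.ip_add_right, star_add, E.star_ip, E.star_ip]

theorem ip_smul_left (c : ℂ) (ξ η : E.carrier) : E.ip (c • ξ) η = star c • E.ip ξ η := by
  rw [← E.star_ip, E.ip_smul_right, star_smul, E.star_ip]

theorem ip_op_smul_left (a : M) (ξ η : E.carrier) :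
    E.ip (MulOpposite.op a • ξ) η = star a * E.ip ξ η := by
  rw [← E.star_ip, E.ip_op_smul_right, star_mul, E.star_ip]

/-- The inner product as a sesquilinear map. -/
def ipₛₗ : E.carrier →ₗ⋆[ℂ] E.carrier →ₗ[ℂ] M where
  toFun ξ :=
    { toFun := E.ip ξ
      map_add' := E.ip_add_right ξ
      map_smul' := fun c η => E.ip_smul_right c ξ η }
  map_add' ξ η := by ext ζ; exact E.ip_add_left ξ η ζ
  map_smul' c ξ := by ext ζ; exact E.ip_smul_left c ξ ζ

theorem ip_sum_right {ι : Type*} (s : Finset ι) (ξ : E.carrier) (f : ι → E.carrier) :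
    E.ip ξ (∑ i ∈ s, f i) = ∑ i ∈ s, E.ip ξ (f i) :=
  map_sum (E.ipₛₗ ξ) f s

theorem ip_sum_left {ι : Type*} (s : Finset ι) (ξ : E.carrier) (f : ι → E.carrier) :
    E.ip (∑ i ∈ s, f i) ξ = ∑ i ∈ s, E.ip (f i) ξ := by
  rw [← E.star_ip, E.ip_sum_right, star_sum]
  simp [E.star_ip]

theorem eq_zero_of_ip_self (ξ : E.carrier) (h : E.ip ξ ξ = 0) : ξ = 0 := by
  have := E.norm_sq ξ
  rw [h, norm_zero] at this
  simpa using this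

/-- The Gram matrix of a finite family in a correspondence. -/
def gram {k : ℕ} (ξ : Fin k → E.carrier) : CStarMatrix (Fin k) (Fin k) M :=
  CStarMatrix.ofMatrix fun i j => E.ip (ξ i) (ξ j)

/-- The family `ξ · B` for a matrix `B` over `M`. -/
def rowMul {k : ℕ} (ξ : Fin k → E.carrier) (B : CStarMatrix (Fin k) (Fin k) M) :
    Fin k → E.carrier :=
  fun j => ∑ i, MulOpposite.op (B i j) • ξ i

@[simp]
theorem gram_apply {k : ℕ} (ξ : Fin k → E.carrier) (i j : Fin k) :
    E.gram ξ i j = E.ip (ξ i) (ξ j) := rfl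

theorem gram_rowMul {k : ℕ} (ξ : Fin k → E.carrier) (B : CStarMatrix (Fin k) (Fin k) M) :
    E.gram (E.rowMul ξ B) = star B * E.gram ξ * B := by
  ext i j
  simp only [gram_apply, rowMul, CStarMatrix.mul_apply,
    CStarMatrix.star_apply, ip_sum_left, ip_sum_right, ip_op_smul_right, ip_op_smul_left,
    Finset.sum_mul]

theorem exists_gram_factor {k : ℕ} (ξ : Fin k → E.carrier) :
    ∃ B : CStarMatrix (Fin k) (Fin k) M, ∀ i j, E.ip (ξ i) (ξ j) = ∑ l, star (B l i) * B l j := by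
  have hsa : star (E.gram ξ) = E.gram ξ := by
    ext i j
    simp only [CStarMatrix.star_apply, gram_apply, E.star_ip]
  have key : ∃ B : CStarMatrix (Fin k) (Fin k) M, E.gram ξ = star B * B := by
    refine exists_factor_of_compression _ hsa fun P C hP hC => ?_
    have h1 : E.gram (E.rowMul ξ P) = P * E.gram ξ * P := by rw [gram_rowMul, hP]
    have h2 : E.rowMul ξ P = 0 := by
      funext i
      apply E.eq_zero_of_ip_self
      apply le_antisymm _ (E.ip_self_nonneg _)
      have h3 : E.gram (E.rowMul ξ P) i i = -((star C * C) i i) := by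
        rw [h1, hC]; rfl
      rw [gram_apply] at h3
      rw [h3, CStarMatrix.mul_apply, neg_nonpos]
      exact Finset.sum_nonneg fun l _ => by
        rw [CStarMatrix.star_apply]; exact star_mul_self_nonneg _
    rw [← h1, h2]
    ext i j
    exact map_zero (E.ipₛₗ (0 : E.carrier))
  obtain ⟨B, hB⟩ := key
  refine ⟨B, fun i j => ?_⟩
  have : E.gram ξ i j = (star B * B) i j := by rw [hB]
  simpa only [gram_apply, CStarMatrix.mul_apply, CStarMatrix.star_apply] using this

end WStarCorr

end Gram

section Tensor

variable {M : Type u} [CStarAlgebra M] [PartialOrder M] [StarOrderedRing M]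
variable (E : WStarCorr.{u, v} M) (R : HRep.{u, w} M)

/-- The sesquilinear form `⟨ξ ⊗ h, η ⊗ k⟩ = ⟨h, σ(⟨ξ, η⟩) k⟩` on the algebraic tensor product. -/
def tensForm : E.carrier ⊗[ℂ] R.space →ₗ⋆[ℂ] E.carrier ⊗[ℂ] R.space →ₗ[ℂ] ℂ :=
  TensorProduct.lift <| LinearMap.mk₂'ₛₗ (starRingEnd ℂ) (starRingEnd ℂ)
    (fun ξ h => TensorProduct.lift <| LinearMap.mk₂ ℂ
      (fun η k => inner ℂ h (R.rep (E.ip ξ η) k))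
      (fun η₁ η₂ k => by simp [E.ip_add_right])
      (fun c η k => by simp [E.ip_smul_right])
      (fun η k₁ k₂ => by simp)
      (fun c η k => by simp))
    (fun ξ₁ ξ₂ h => by ext η k; simp [E.ip_add_left])
    (fun c ξ h => by ext η k; simp [E.ip_smul_left])
    (fun ξ h₁ h₂ => by ext η k; simp)
    (fun c ξ h => by ext η k; simp [mul_comm])

@[simp]
theorem tensForm_tmul (ξ η : E.carrier) (h k : R.space) :
    tensForm E R (ξ ⊗ₜ h) (η ⊗ₜ k) = inner ℂ h (R.rep (E.ip ξ η) k) := rfl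

/-- With `⟨ξ i, ξ j⟩ = (B* B) i j`, the form of `∑ ξ i ⊗ h i` is `∑ l, ‖∑ j, σ(B l j) h j‖²`. -/
theorem gram_sum_eq {k : ℕ} (ξ : Fin k → E.carrier) (B : CStarMatrix (Fin k) (Fin k) M)
    (hB : ∀ i j, E.ip (ξ i) (ξ j) = ∑ l, star (B l i) * B l j)
    (h h' : Fin k → R.space) :
    ∑ i, ∑ j, inner ℂ (h i) (R.rep (E.ip (ξ i) (ξ j)) (h' j)) =
      ∑ l, inner ℂ (∑ i, R.rep (B l i) (h i)) (∑ j, R.rep (B l j) (h' j)) := by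
  rw [R.sum_inner_sum B h h']
  simp only [hB]

theorem tensForm_sum {k : ℕ} (ξ : Fin k → E.carrier) (h : Fin k → R.space) :
    tensForm E R (∑ i, ξ i ⊗ₜ h i) (∑ i, ξ i ⊗ₜ h i) =
      ∑ i, ∑ j, inner ℂ (h i) (R.rep (E.ip (ξ i) (ξ j)) (h j)) := by
  simp only [map_sum, LinearMap.sum_apply, tensForm_tmul]
  exact Finset.sum_comm

theorem tensForm_conj (x y : E.carrier ⊗[ℂ] R.space) :
    starRingEnd ℂ (tensForm E R y x) = tensForm E R x y := by
  induction x with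
  | zero => simp
  | add x₁ x₂ h₁ h₂ => simp [h₁, h₂]
  | tmul ξ h =>
    induction y with
    | zero => simp
    | add y₁ y₂ h₁ h₂ => simp [h₁, h₂]
    | tmul η k =>
      rw [tensForm_tmul, tensForm_tmul, inner_conj_symm, R.inner_rep_left, E.star_ip]

/-- The positive semidefinite form on the algebraic tensor product. -/
@[reducible]
def preTensCore : PreInnerProductSpace.Core ℂ (E.carrier ⊗[ℂ] R.space) where
  inner x y := tensForm E R x y
  conj_inner_symm := tensForm_conj E R
  re_inner_nonneg x := by
    obtain ⟨k, ξ, h, rfl⟩ := TensorProduct.exists_sum_tmul_eq x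
    obtain ⟨B, hB⟩ := E.exists_gram_factor ξ
    rw [tensForm_sum, gram_sum_eq E R ξ B hB, map_sum]
    exact Finset.sum_nonneg fun l _ => inner_self_nonneg
  add_left x y z := by simp
  smul_left x y c := by simp

/-- The algebraic tensor product with the semi-inner product of the interior tensor product. -/
def PreTens : Type (max v w) := E.carrier ⊗[ℂ] R.space

instance : SeminormedAddCommGroup (PreTens E R) :=
  @InnerProductSpace.Core.toSeminormedAddCommGroup ℂ (E.carrier ⊗[ℂ] R.space) _ _ _
    (preTensCore E R)

instance : InnerProductSpace ℂ (PreTens E R) :=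
  InnerProductSpace.ofCore (preTensCore E R)

/-- The Hilbert space `E ⊗_σ H`: the Hausdorff completion of the algebraic tensor product. -/
abbrev TensSpace : Type (max v w) := UniformSpace.Completion (PreTens E R)

/-- The canonical map of the algebraic tensor product into `E ⊗_σ H`. -/
def toTens : E.carrier ⊗[ℂ] R.space →ₗ[ℂ] TensSpace E R where
  toFun x := ((show PreTens E R from x : PreTens E R) : TensSpace E R)
  map_add' x y := UniformSpace.Completion.coe_add (α := PreTens E R) x y
  map_smul' c x := UniformSpace.Completion.coe_smul (X := PreTens E R) c x

/-- The vector `ξ ⊗ h` of `E ⊗_σ H`. -/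
def tmul (ξ : E.carrier) (h : R.space) : TensSpace E R := toTens E R (ξ ⊗ₜ h)

theorem denseRange_toTens : DenseRange (toTens E R) :=
  UniformSpace.Completion.denseRange_coe (α := PreTens E R)

theorem inner_toTens (x y : E.carrier ⊗[ℂ] R.space) :
    inner ℂ (toTens E R x) (toTens E R y) = tensForm E R x y :=
  UniformSpace.Completion.inner_coe (E := PreTens E R) x y

theorem inner_tmul (ξ η : E.carrier) (h k : R.space) :
    inner ℂ (tmul E R ξ h) (tmul E R η k) = inner ℂ h (R.rep (E.ip ξ η) k) :=
  inner_toTens E R _ _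

theorem norm_sq_sum_tmul {k : ℕ} (ξ : Fin k → E.carrier) (h : Fin k → R.space) :
    ‖∑ i, tmul E R (ξ i) (h i)‖ ^ 2 =
      (∑ i, ∑ j, inner ℂ (h i) (R.rep (E.ip (ξ i) (ξ j)) (h j))).re := by
  have : ∑ i, tmul E R (ξ i) (h i) = toTens E R (∑ i, ξ i ⊗ₜ h i) := by simp [tmul]
  rw [this, @norm_sq_eq_re_inner ℂ, inner_toTens, tensForm_sum]
  rfl

/-- The map `(ξ, h) ↦ ξ ⊗ h` as a bilinear map. -/
def tmulₗ : E.carrier →ₗ[ℂ] R.space →ₗ[ℂ] TensSpace E R :=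
  (TensorProduct.mk ℂ E.carrier R.space).compr₂ (toTens E R)

@[simp]
theorem tmulₗ_apply (ξ : E.carrier) (h : R.space) : tmulₗ E R ξ h = tmul E R ξ h := rfl

theorem tens_induction {p : TensSpace E R → Prop} (hc : IsClosed {z | p z})
    (hs : ∀ (k : ℕ) (ξ : Fin k → E.carrier) (h : Fin k → R.space), p (∑ i, tmul E R (ξ i) (h i)))
    (z : TensSpace E R) : p z := by
  refine (denseRange_toTens E R).induction_on (p := p) z hc fun x => ?_
  obtain ⟨k, ξ, h, rfl⟩ := TensorProduct.exists_sum_tmul_eq x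
  simpa [tmul] using hs k ξ h

variable {E R}

theorem tens_ext {K : Type*} [NormedAddCommGroup K] [NormedSpace ℂ K]
    {f g : TensSpace E R →L[ℂ] K} (h : ∀ ξ x, f (tmul E R ξ x) = g (tmul E R ξ x)) : f = g := by
  ext z
  refine tens_induction E R (p := fun z => f z = g z)
    (isClosed_eq f.continuous g.continuous) (fun k ξ x => ?_) z
  simp [h]

/-- The operator on `E ⊗_σ H` determined by a bilinear map that is bounded for the norm of
`E ⊗_σ H` on finite sums of elementary tensors. -/
def tensLift {K : Type*} [NormedAddCommGroup K] [NormedSpace ℂ K] [CompleteSpace K]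
    (B : E.carrier →ₗ[ℂ] R.space →ₗ[ℂ] K) : TensSpace E R →L[ℂ] K :=
  (TensorProduct.lift B).extendOfNorm (toTens E R)

/-- The bilinear map `B` extends to a bounded operator on `E ⊗_σ H`, of norm at most `C`. -/
def TensBound {K : Type*} [NormedAddCommGroup K] [NormedSpace ℂ K]
    (B : E.carrier →ₗ[ℂ] R.space →ₗ[ℂ] K) (C : ℝ) : Prop :=
  0 ≤ C ∧ ∀ (k : ℕ) (ξ : Fin k → E.carrier) (h : Fin k → R.space),
    ‖∑ i, B (ξ i) (h i)‖ ≤ C * ‖∑ i, tmul E R (ξ i) (h i)‖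

theorem TensBound.bound {K : Type*} [NormedAddCommGroup K] [NormedSpace ℂ K]
    {B : E.carrier →ₗ[ℂ] R.space →ₗ[ℂ] K} {C : ℝ} (hB : TensBound B C)
    (x : E.carrier ⊗[ℂ] R.space) : ‖TensorProduct.lift B x‖ ≤ C * ‖toTens E R x‖ := by
  obtain ⟨k, ξ, h, rfl⟩ := TensorProduct.exists_sum_tmul_eq x
  simpa [tmul] using hB.2 k ξ h

theorem tensLift_tmul {K : Type*} [NormedAddCommGroup K] [NormedSpace ℂ K] [CompleteSpace K]
    {B : E.carrier →ₗ[ℂ] R.space →ₗ[ℂ] K} {C : ℝ} (hB : TensBound B C)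
    (ξ : E.carrier) (h : R.space) : tensLift B (tmul E R ξ h) = B ξ h := by
  rw [tensLift, tmul, LinearMap.extendOfNorm_eq (denseRange_toTens E R) ⟨C, hB.bound⟩]
  rfl

theorem norm_tensLift_le {K : Type*} [NormedAddCommGroup K] [NormedSpace ℂ K] [CompleteSpace K]
    {B : E.carrier →ₗ[ℂ] R.space →ₗ[ℂ] K} {C : ℝ} (hB : TensBound B C) : ‖tensLift B‖ ≤ C :=
  LinearMap.opNorm_extendOfNorm_le (denseRange_toTens E R) hB.1 hB.bound

variable (E R)

/-- The bilinear map `(ξ, h) ↦ aξ ⊗ h`. -/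
def leftBilin (a : M) : E.carrier →ₗ[ℂ] R.space →ₗ[ℂ] TensSpace E R :=
  LinearMap.mk₂ ℂ (fun ξ h => tmul E R (a • ξ) h)
    (fun ξ₁ ξ₂ h => by rw [smul_add, ← tmulₗ_apply, map_add]; rfl)
    (fun c ξ h => by
      have : a • c • ξ = c • a • ξ := by
        have h1 : c • ξ = (c • (1 : M)) • ξ := by rw [smul_assoc, one_smul]
        rw [h1, smul_smul, mul_smul_comm, mul_one, smul_assoc]
      rw [this, ← tmulₗ_apply, map_smul]; rfl)
    (fun ξ h₁ h₂ => by rw [← tmulₗ_apply, map_add]; rfl)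
    (fun c ξ h => by rw [← tmulₗ_apply, map_smul]; rfl)

theorem leftBilin_bound (a : M) : TensBound (leftBilin E R a) ‖a‖ := by
  refine ⟨norm_nonneg a, fun k ξ h => ?_⟩
  have h1 : star a * a ≤ algebraMap ℝ M (‖a‖ ^ 2) := CStarAlgebra.star_mul_le_algebraMap_norm_sq
  obtain ⟨b, hb⟩ := CStarAlgebra.nonneg_iff_eq_star_mul_self.mp (sub_nonneg.mpr h1)
  have h2 : ∀ i j, E.ip (b • ξ i) (b • ξ j) =
      ((‖a‖ ^ 2 : ℝ) : ℂ) • E.ip (ξ i) (ξ j) - E.ip (a • ξ i) (a • ξ j) := fun i j => by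
    rw [E.left_adjoint, E.left_adjoint, smul_smul, smul_smul, ← hb, sub_smul, sub_eq_add_neg,
      ← neg_one_smul ℂ (_ • ξ j), E.ip_add_right, E.ip_smul_right, neg_one_smul, ← sub_eq_add_neg]
    congr 1
    rw [Algebra.algebraMap_eq_smul_one, ← E.ip_smul_right]
    congr 1
    rw [← Complex.coe_smul, smul_assoc, one_smul]
  have h3 := norm_sq_sum_tmul E R (fun i => b • ξ i) h
  have h4 := norm_sq_sum_tmul E R (fun i => a • ξ i) h
  have h5 := norm_sq_sum_tmul E R ξ h
  have h6 : (∑ i, ∑ j, inner ℂ (h i) (R.rep (E.ip (b • ξ i) (b • ξ j)) (h j))).re =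
      ‖a‖ ^ 2 * (∑ i, ∑ j, inner ℂ (h i) (R.rep (E.ip (ξ i) (ξ j)) (h j))).re -
        (∑ i, ∑ j, inner ℂ (h i) (R.rep (E.ip (a • ξ i) (a • ξ j)) (h j))).re := by
    rw [← Complex.re_ofReal_mul, ← Complex.sub_re]
    congr 1
    simp only [h2, map_sub, map_smul, sub_apply,
      smul_apply, inner_sub_right, inner_smul_right, Finset.sum_sub_distrib,
      Finset.mul_sum]
  refine (sq_le_sq₀ (norm_nonneg _) (by positivity)).mp ?_
  have h7 : ∑ i, leftBilin E R a (ξ i) (h i) = ∑ i, tmul E R (a • ξ i) (h i) := rfl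
  rw [mul_pow, h7, h4, h5]
  nlinarith [sq_nonneg ‖∑ i, tmul E R (b • ξ i) (h i)‖]

/-- The operator `φ(a) ⊗ I` on `E ⊗_σ H`. -/
def leftAct (a : M) : TensSpace E R →L[ℂ] TensSpace E R := tensLift (leftBilin E R a)

@[simp]
theorem leftAct_tmul (a : M) (ξ : E.carrier) (h : R.space) :
    leftAct E R a (tmul E R ξ h) = tmul E R (a • ξ) h :=
  tensLift_tmul (leftBilin_bound E R a) ξ h

theorem add_tmul (ξ η : E.carrier) (h : R.space) :
    tmul E R (ξ + η) h = tmul E R ξ h + tmul E R η h := by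
  rw [← tmulₗ_apply, map_add]; rfl

theorem smul_tmul (c : ℂ) (ξ : E.carrier) (h : R.space) :
    tmul E R (c • ξ) h = c • tmul E R ξ h := by
  rw [← tmulₗ_apply, map_smul]; rfl

theorem tmul_add (ξ : E.carrier) (h k : R.space) :
    tmul E R ξ (h + k) = tmul E R ξ h + tmul E R ξ k := by
  rw [← tmulₗ_apply, map_add]; rfl

theorem tmul_smul (c : ℂ) (ξ : E.carrier) (h : R.space) :
    tmul E R ξ (c • h) = c • tmul E R ξ h := by
  rw [← tmulₗ_apply, map_smul]; rfl

/-- `E ⊗_σ H` with the representation `a ↦ φ(a) ⊗ I`. -/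
def tens : HRep.{u, max v w} M where
  space := TensSpace E R
  rep :=
    { toFun := leftAct E R
      map_one' := tens_ext fun ξ h => by simp
      map_mul' := fun a b => tens_ext fun ξ h => by simp [mul_smul]
      map_zero' := tens_ext fun ξ h => by
        rw [leftAct_tmul, zero_smul, ← tmulₗ_apply, map_zero]; rfl
      map_add' := fun a b => tens_ext fun ξ h => by simp [add_smul, add_tmul]
      commutes' := fun c => tens_ext fun ξ h => by
        rw [leftAct_tmul, Algebra.algebraMap_eq_smul_one, Algebra.algebraMap_eq_smul_one,
          smul_assoc, one_smul, smul_tmul]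
        rfl
      map_star' := fun a => by
        rw [ContinuousLinearMap.star_eq_adjoint, ContinuousLinearMap.eq_adjoint_iff]
        intro x y
        refine tens_induction E R
          (p := fun x => inner ℂ (leftAct E R (star a) x) y = inner ℂ x (leftAct E R a y))
          (isClosed_eq (by fun_prop) (by fun_prop)) (fun k ξ h => ?_) x
        refine tens_induction E R
          (p := fun y => inner ℂ (leftAct E R (star a) (∑ i, tmul E R (ξ i) (h i))) y =
            inner ℂ (∑ i, tmul E R (ξ i) (h i)) (leftAct E R a y))
          (isClosed_eq (by fun_prop) (by fun_prop)) (fun l η g => ?_) y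
        simp [inner_sum, sum_inner, inner_tmul, E.left_adjoint] }

end Tensor

section HomToolkit

variable {M : Type u} [CStarAlgebra M]

namespace Hom

variable {R : HRep.{u, w} M} {S : HRep.{u, w₁} M} {T : HRep.{u, w₂} M}

/-- The identity intertwiner. -/
def id (R : HRep.{u, w} M) : Hom R R where
  op := ContinuousLinearMap.id ℂ R.space
  comm _ _ := rfl

/-- Composition of intertwiners. -/
def comp (f : Hom S T) (g : Hom R S) : Hom R T where
  op := f.op ∘L g.op
  comm a x := by simp [f.comm, g.comm]

/-- The adjoint of an intertwiner. -/
def adj (f : Hom R S) : Hom S R where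
  op := ContinuousLinearMap.adjoint f.op
  comm a x := by
    refine ext_inner_right ℂ fun y => ?_
    rw [ContinuousLinearMap.adjoint_inner_left, S.inner_rep_left, R.inner_rep_left,
      ContinuousLinearMap.adjoint_inner_left, f.comm]

instance : Zero (Hom R S) := ⟨{ op := 0, comm := fun a x => by simp }⟩

instance : Add (Hom R S) := ⟨fun f g =>
  { op := f.op + g.op, comm := fun a x => by simp [f.comm, g.comm] }⟩

/-- A unitary intertwiner. -/
def IsUnitary (f : Hom R S) : Prop := (adj f).comp f = Hom.id R ∧ f.comp (adj f) = Hom.id S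

end Hom

end HomToolkit

infixr:80 " ⊚ " => Hom.comp

postfix:max "†" => Hom.adj

section TensorMaps

variable {M : Type u} [CStarAlgebra M] [PartialOrder M] [StarOrderedRing M]

theorem norm_sq_factor (E : WStarCorr.{u, v} M) (R : HRep.{u, w} M) {k : ℕ}
    (ξ : Fin k → E.carrier) (B : CStarMatrix (Fin k) (Fin k) M)
    (hB : ∀ i j, E.ip (ξ i) (ξ j) = ∑ l, star (B l i) * B l j) (h : Fin k → R.space) :
    ‖∑ i, tmul E R (ξ i) (h i)‖ ^ 2 = ∑ l, ‖∑ j, R.rep (B l j) (h j)‖ ^ 2 := by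
  rw [norm_sq_sum_tmul, gram_sum_eq E R ξ B hB, Complex.re_sum]
  refine Finset.sum_congr rfl fun l _ => ?_
  rw [@norm_sq_eq_re_inner ℂ]; rfl

variable {R : HRep.{u, w} M} {S : HRep.{u, w₁} M}

/-- The bilinear map `(ξ, h) ↦ ξ ⊗ f h`. -/
def tmapBilin (E : WStarCorr.{u, v} M) (f : Hom R S) :
    E.carrier →ₗ[ℂ] R.space →ₗ[ℂ] TensSpace E S :=
  (tmulₗ E S).compl₂ (f.op : R.space →ₗ[ℂ] S.space)

theorem tmapBilin_bound (E : WStarCorr.{u, v} M) (f : Hom R S) :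
    TensBound (tmapBilin E f) ‖f.op‖ := by
  refine ⟨norm_nonneg _, fun k ξ h => ?_⟩
  obtain ⟨B, hB⟩ := E.exists_gram_factor ξ
  refine (sq_le_sq₀ (norm_nonneg _) (by positivity)).mp ?_
  have h1 : ∑ i, tmapBilin E f (ξ i) (h i) = ∑ i, tmul E S (ξ i) (f.op (h i)) := rfl
  rw [h1, mul_pow, norm_sq_factor E S ξ B hB, norm_sq_factor E R ξ B hB, Finset.mul_sum]
  refine Finset.sum_le_sum fun l _ => ?_
  have h2 : ∑ j, S.rep (B l j) (f.op (h j)) = f.op (∑ j, R.rep (B l j) (h j)) := by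
    rw [map_sum]
    exact Finset.sum_congr rfl fun j _ => (f.comm _ _).symm
  rw [h2, ← mul_pow]
  exact pow_le_pow_left₀ (norm_nonneg _) (f.op.le_opNorm _) 2

/-- The operator `I_E ⊗ f`. -/
def tmap (E : WStarCorr.{u, v} M) (f : Hom R S) : Hom (tens E R) (tens E S) where
  op := tensLift (tmapBilin E f)
  comm a x := by
    have h : tensLift (tmapBilin E f) ∘L leftAct E R a =
        leftAct E S a ∘L tensLift (tmapBilin E f) := tens_ext fun ξ h => by
      rw [ContinuousLinearMap.comp_apply, ContinuousLinearMap.comp_apply, leftAct_tmul,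
        tensLift_tmul (tmapBilin_bound E f), tensLift_tmul (tmapBilin_bound E f)]
      exact (leftAct_tmul E S a ξ (f.op h)).symm
    exact DFunLike.congr_fun h x

theorem tmap_tmul (E : WStarCorr.{u, v} M) (f : Hom R S) (ξ : E.carrier) (h : R.space) :
    (tmap E f).op (tmul E R ξ h) = tmul E S ξ (f.op h) :=
  tensLift_tmul (tmapBilin_bound E f) ξ h

theorem norm_tmap_le (E : WStarCorr.{u, v} M) (f : Hom R S) : ‖(tmap E f).op‖ ≤ ‖f.op‖ :=
  norm_tensLift_le (tmapBilin_bound E f)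

end TensorMaps

section Covariant

variable {M : Type u} [CStarAlgebra M] [PartialOrder M] [StarOrderedRing M]

/-- A completely contractive covariant representation `(σ, T)` of `E`, with `σ` the given
representation `R`. The norm of a matrix over `E` is `‖(ξ i j)‖² = ‖(∑ l, ⟨ξ l i, ξ l j⟩) i j‖`. -/
structure CCRep (E : WStarCorr.{u, v} M) (R : HRep.{u, w} M) where
  T : E.carrier →ₗ[ℂ] (R.space →L[ℂ] R.space)
  covariant : ∀ (a b : M) (ξ : E.carrier),
    T (a • MulOpposite.op b • ξ) = R.rep a ∘L T ξ ∘L R.rep b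
  completelyContractive : ∀ (k : ℕ) (ξ : Fin k → Fin k → E.carrier) (h : Fin k → R.space),
    ∑ i, ‖∑ j, T (ξ i j) (h j)‖ ^ 2 ≤
      ‖CStarMatrix.ofMatrix fun i j => ∑ l, E.ip (ξ l i) (ξ l j)‖ * ∑ j, ‖h j‖ ^ 2

/-- In a C*-algebra, `G + ε = P* P` for an invertible `P`, and then `‖P⁻¹* G P⁻¹‖ ≤ 1`. -/
theorem exists_regularized_factor {A : Type*} [CStarAlgebra A] (B : A) {ε : ℝ} (hε : 0 < ε) :
    ∃ P S : A, star P * P = star B * B + (ε : ℂ) • (1 : A) ∧ S * P = 1 ∧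
      ‖star S * (star B * B) * S‖ ≤ 1 := by
  let _ := CStarAlgebra.spectralOrder A
  let _ := CStarAlgebra.spectralOrderedRing A
  have hG : 0 ≤ star B * B := star_mul_self_nonneg B
  have hεA : IsStrictlyPositive (algebraMap ℝ A ε) := by
    cases subsingleton_or_nontrivial A
    · rw [IsStrictlyPositive.iff_of_unital]
      exact ⟨le_of_eq (Subsingleton.elim _ _), isUnit_of_subsingleton _⟩
    · exact isStrictlyPositive_algebraMap hε
  have hεs : algebraMap ℝ A ε = (ε : ℂ) • (1 : A) := by
    rw [Algebra.algebraMap_eq_smul_one, Complex.coe_smul]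
  have hX : 0 ≤ star B * B + algebraMap ℝ A ε := add_nonneg hG hεA.nonneg
  have hu : IsUnit (star B * B + algebraMap ℝ A ε) :=
    CStarAlgebra.isUnit_of_le _ (le_add_of_nonneg_left hG) hεA
  set X := star B * B + algebraMap ℝ A ε with hXdef
  have hP : 0 ≤ CFC.sqrt X := CFC.sqrt_nonneg X
  have hPP : CFC.sqrt X * CFC.sqrt X = X := CFC.sqrt_mul_sqrt_self X
  have hPs : star (CFC.sqrt X) = CFC.sqrt X := (IsSelfAdjoint.of_nonneg hP).star_eq
  have hPu : IsUnit (CFC.sqrt X) := by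
    rw [← hPP] at hu
    exact (Commute.refl (CFC.sqrt X)).isUnit_mul_iff.mp hu |>.1
  obtain ⟨p, hp⟩ := hPu
  refine ⟨CFC.sqrt X, (↑p⁻¹ : A), by rw [hPs, hPP, hXdef, hεs], by rw [← hp, Units.inv_mul], ?_⟩
  have h1 : star (↑p⁻¹ : A) * (star B * B) * ↑p⁻¹ ≤ star (↑p⁻¹ : A) * X * ↑p⁻¹ :=
    star_left_conjugate_le_conjugate (le_add_of_nonneg_right hεA.nonneg) _
  have h2 : star (↑p⁻¹ : A) * X * ↑p⁻¹ = 1 := by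
    rw [← hPP]
    nth_rw 1 [← hPs]
    rw [← mul_assoc, ← star_mul, ← hp, Units.mul_inv, star_one, one_mul, Units.mul_inv]
  rw [CStarAlgebra.norm_le_one_iff_of_nonneg _ (star_left_conjugate_nonneg hG _), ← h2]
  exact h1

theorem WStarCorr.rowMul_one (E : WStarCorr.{u, v} M) {k : ℕ} (ξ : Fin k → E.carrier) :
    E.rowMul ξ 1 = ξ := by
  funext j
  have : ∀ i, MulOpposite.op ((1 : CStarMatrix (Fin k) (Fin k) M) i j) • ξ i =
      if i = j then ξ i else 0 := fun i => by
    rw [CStarMatrix.one_apply]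
    split_ifs <;> simp
  simp [rowMul, this]

theorem WStarCorr.rowMul_rowMul (E : WStarCorr.{u, v} M) {k : ℕ} (ξ : Fin k → E.carrier)
    (B C : CStarMatrix (Fin k) (Fin k) M) : E.rowMul (E.rowMul ξ B) C = E.rowMul ξ (B * C) := by
  funext j
  simp only [rowMul, Finset.smul_sum, smul_smul, ← MulOpposite.op_mul, CStarMatrix.mul_apply]
  rw [Finset.sum_comm]
  refine Finset.sum_congr rfl fun i _ => ?_
  rw [← Finset.sum_smul]
  congr 1
  exact (map_sum MulOpposite.opAddEquiv _ _).symm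

theorem WStarCorr.gram_zero_rows (E : WStarCorr.{u, v} M) {k : ℕ} (ξ : Fin (k + 1) → E.carrier) :
    (CStarMatrix.ofMatrix fun i j =>
      ∑ l : Fin (k + 1), E.ip (if l = 0 then ξ i else 0) (if l = 0 then ξ j else 0)) =
      E.gram ξ := by
  ext i j
  have h0 : ∀ η, E.ip η 0 = 0 := fun η => map_zero (E.ipₛₗ η)
  have h : ∀ l : Fin (k + 1), E.ip (if l = 0 then ξ i else 0) (if l = 0 then ξ j else 0) =
      if l = 0 then E.ip (ξ i) (ξ j) else 0 := fun l => by split_ifs <;> simp [h0]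
  rw [WStarCorr.gram_apply]
  change ∑ l : Fin (k + 1), E.ip (if l = 0 then ξ i else 0) (if l = 0 then ξ j else 0) = _
  simp [h]

namespace CCRep

variable {E : WStarCorr.{u, v} M} {R : HRep.{u, w} M} (τ : CCRep E R)

theorem map_op_smul (b : M) (ξ : E.carrier) (h : R.space) :
    τ.T (MulOpposite.op b • ξ) h = τ.T ξ (R.rep b h) := by
  have := τ.covariant 1 b ξ
  rw [one_smul, map_one] at this
  rw [this]; rfl

theorem map_smul_left (a : M) (ξ : E.carrier) (h : R.space) :
    τ.T (a • ξ) h = R.rep a (τ.T ξ h) := by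
  have := τ.covariant a 1 ξ
  rw [MulOpposite.op_one, one_smul, map_one] at this
  rw [this]; rfl

theorem row_bound {k : ℕ} (ξ : Fin (k + 1) → E.carrier) (h : Fin (k + 1) → R.space) :
    ‖∑ j, τ.T (ξ j) (h j)‖ ^ 2 ≤ ‖E.gram ξ‖ * ∑ j, ‖h j‖ ^ 2 := by
  have := τ.completelyContractive (k + 1) (fun l j => if l = 0 then ξ j else 0) h
  rw [E.gram_zero_rows] at this
  refine le_trans ?_ this
  refine le_trans (le_of_eq ?_) (Finset.single_le_sum
    (f := fun i => ‖∑ j, τ.T (if i = 0 then ξ j else 0) (h j)‖ ^ 2)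
    (fun i _ => sq_nonneg _) (Finset.mem_univ 0))
  simp

/-- The bilinear map `(ξ, h) ↦ T(ξ) h`. -/
def bilin : E.carrier →ₗ[ℂ] R.space →ₗ[ℂ] R.space :=
  LinearMap.mk₂ ℂ (fun ξ h => τ.T ξ h) (fun _ _ _ => by simp) (fun _ _ _ => by simp)
    (fun _ _ _ => by simp) (fun _ _ _ => by simp)

theorem bilin_bound : TensBound τ.bilin 1 := by
  refine ⟨zero_le_one, fun k ξ h => ?_⟩
  rw [one_mul]
  refine (sq_le_sq₀ (norm_nonneg _) (norm_nonneg _)).mp ?_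
  obtain _ | k := k
  · simp
  obtain ⟨B, hB⟩ := E.exists_gram_factor ξ
  have hG : E.gram ξ = star B * B := by
    ext i j
    rw [WStarCorr.gram_apply, hB, CStarMatrix.mul_apply]
    rfl
  refine le_of_forall_pos_le_add fun δ hδ => ?_
  set N := ∑ j, ‖h j‖ ^ 2 with hN
  have hN0 : 0 ≤ N := Finset.sum_nonneg fun _ _ => sq_nonneg _
  obtain ⟨P, S, hP, hSP, hS⟩ := exists_regularized_factor B (show 0 < δ / (N + 1) by positivity)
  set g : Fin (k + 1) → R.space := fun l => ∑ j, R.rep (P l j) (h j) with hg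
  have h1 : ∑ j, τ.bilin (ξ j) (h j) = ∑ l, τ.T (E.rowMul ξ S l) (g l) := by
    have h4 : E.rowMul (E.rowMul ξ S) P = ξ := by rw [E.rowMul_rowMul, hSP, E.rowMul_one]
    have h5 : ∀ j, τ.bilin (ξ j) (h j) = ∑ l, τ.T (E.rowMul ξ S l) (R.rep (P l j) (h j)) :=
      fun j => by
        conv_lhs => rw [← h4]
        simp only [bilin, LinearMap.mk₂_apply]
        rw [WStarCorr.rowMul, map_sum, sum_apply]
        simp [τ.map_op_smul]
    simp only [h5, hg, map_sum]
    exact Finset.sum_comm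
  have h2 : ∑ l, ‖g l‖ ^ 2 = ‖∑ i, tmul E R (ξ i) (h i)‖ ^ 2 + δ / (N + 1) * N := by
    have h6 : ∀ i j, ∑ l, star (P l i) * P l j =
        E.ip (ξ i) (ξ j) + (if i = j then ((δ / (N + 1) : ℝ) : ℂ) else 0) • (1 : M) := fun i j => by
      have h7 : (star P * P) i j = (star B * B) i j + ((δ / (N + 1) : ℝ) : ℂ) •
          (1 : CStarMatrix (Fin (k + 1)) (Fin (k + 1)) M) i j := by rw [hP]; rfl
      rw [← hG, CStarMatrix.mul_apply] at h7
      simp only [CStarMatrix.star_apply, WStarCorr.gram_apply] at h7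
      rw [h7, CStarMatrix.one_apply]
      split_ifs <;> simp
    have h8 : ∑ l, ‖g l‖ ^ 2 = (∑ l, inner ℂ (g l) (g l)).re := by
      rw [Complex.re_sum]
      exact Finset.sum_congr rfl fun l _ => by rw [@norm_sq_eq_re_inner ℂ]; rfl
    rw [h8, norm_sq_sum_tmul]
    simp only [hg]
    rw [R.sum_inner_sum P h h]
    simp only [h6, map_add, add_apply, inner_add_right, Finset.sum_add_distrib, Complex.add_re]
    congr 1
    have h9 : ∀ i j, inner ℂ (h i)
        (R.rep ((if i = j then ((δ / (N + 1) : ℝ) : ℂ) else 0) • (1 : M)) (h j)) =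
          if i = j then ((δ / (N + 1) * ‖h i‖ ^ 2 : ℝ) : ℂ) else 0 := fun i j => by
      split_ifs with hij
      · subst hij
        rw [map_smul, map_one, smul_apply, one_apply_eq_self, inner_smul_right,
          inner_self_eq_norm_sq_to_K]
        push_cast
        rfl
      · simp
    simp only [h9, Finset.sum_ite_eq, Finset.mem_univ, if_true, ← Complex.ofReal_sum,
      Complex.ofReal_re, ← Finset.mul_sum]
    rfl
  rw [h1]
  refine (τ.row_bound (E.rowMul ξ S) g).trans ?_
  rw [E.gram_rowMul, hG, h2]
  have h3 : δ / (N + 1) * N ≤ δ := by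
    rw [div_mul_eq_mul_div, div_le_iff₀ (by positivity)]
    nlinarith
  calc _ ≤ 1 * (‖∑ i, tmul E R (ξ i) (h i)‖ ^ 2 + δ / (N + 1) * N) :=
        mul_le_mul_of_nonneg_right hS (by positivity)
    _ ≤ _ := by linarith

/-- The contraction `T̃ : E ⊗ H → H`, `T̃(ξ ⊗ h) = T(ξ) h`. -/
def tilde : Hom (tens E R) R where
  op := tensLift τ.bilin
  comm a x := by
    have h : tensLift τ.bilin ∘L leftAct E R a = R.rep a ∘L tensLift τ.bilin :=
      tens_ext fun ξ h => by
        rw [ContinuousLinearMap.comp_apply, ContinuousLinearMap.comp_apply, leftAct_tmul,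
          tensLift_tmul τ.bilin_bound, tensLift_tmul τ.bilin_bound]
        exact τ.map_smul_left a ξ h
    exact DFunLike.congr_fun h x

theorem tilde_tmul (ξ : E.carrier) (h : R.space) : τ.tilde.op (tmul E R ξ h) = τ.T ξ h :=
  tensLift_tmul τ.bilin_bound ξ h

end CCRep

end Covariant

section ProductSystems

variable {M : Type u} [CStarAlgebra M] [PartialOrder M] [StarOrderedRing M]

/-- The functionals in the predual of `E`: the norm limits of finite sums of functionals
`η ↦ ω⟨ζ, η⟩` with `ω` a positive normal functional on `M`. They define the ultraweak topology of
`E`. -/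
def WStarCorr.IsUltraweak (E : WStarCorr.{u, v} M) (f : E.carrier →ₗ[ℂ] ℂ) : Prop :=
  ∀ ε : ℝ, 0 < ε → ∃ (k : ℕ) (ζ : Fin k → E.carrier) (ω : Fin k → (M →L[ℂ] ℂ)),
    (∀ i, IsNormalFunctional (ω i)) ∧ ∀ η, ‖f η - ∑ i, ω i (E.ip (ζ i) η)‖ ≤ ε * ‖η‖

/-- A product system over `ℕⁿ` of W*-correspondences over `M`. The multiplication
`(ξ, η) ↦ ξη` is bilinear from `X s × X t` to `X (s + t)`; the index equation is an argument.
It is an isomorphism of correspondences of the (self-dual) tensor product of `X s` and `X t` with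
`X (s + t)`: it is an inner product preserving bimodule map and the products span an ultraweakly
dense subspace. The correspondence `X 0` is `M`, acting by the left and the right action. -/
structure ProductSystem (M : Type u) [CStarAlgebra M] [PartialOrder M] [StarOrderedRing M]
    (n : ℕ) where
  X : (Fin n → ℕ) → WStarCorr.{u, v} M
  mul : ∀ {s t r : Fin n → ℕ}, s + t = r →
    ((X s).carrier →ₗ[ℂ] (X t).carrier →ₗ[ℂ] (X r).carrier)
  smul_mul : ∀ {s t r : Fin n → ℕ} (h : s + t = r) (a : M) ξ η,
    mul h (a • ξ) η = a • mul h ξ η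
  mul_balanced : ∀ {s t r : Fin n → ℕ} (h : s + t = r) (a : M) ξ η,
    mul h (MulOpposite.op a • ξ) η = mul h ξ (a • η)
  mul_op_smul : ∀ {s t r : Fin n → ℕ} (h : s + t = r) (a : M) ξ η,
    mul h ξ (MulOpposite.op a • η) = MulOpposite.op a • mul h ξ η
  ip_mul : ∀ {s t r : Fin n → ℕ} (h : s + t = r) ξ η ξ' η',
    (X r).ip (mul h ξ η) (mul h ξ' η') = (X t).ip η ((X s).ip ξ ξ' • η')
  dense_mul : ∀ {s t r : Fin n → ℕ} (h : s + t = r) (f : (X r).carrier →ₗ[ℂ] ℂ),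
    (X r).IsUltraweak f → (∀ ξ η, f (mul h ξ η) = 0) → f = 0
  unit : M ≃ₗ[ℂ] (X 0).carrier
  smul_unit : ∀ a b : M, a • unit b = unit (a * b)
  op_smul_unit : ∀ a b : M, MulOpposite.op a • unit b = unit (b * a)
  ip_unit : ∀ a b : M, (X 0).ip (unit a) (unit b) = star a * b
  unit_mul : ∀ {t : Fin n → ℕ} (h : 0 + t = t) (a : M) η, mul h (unit a) η = a • η
  mul_unit : ∀ {s : Fin n → ℕ} (h : s + 0 = s) ξ (a : M),
    mul h ξ (unit a) = MulOpposite.op a • ξ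
  mul_assoc : ∀ {s t r st tr str : Fin n → ℕ} (h₁ : s + t = st) (h₂ : st + r = str)
    (h₃ : t + r = tr) (h₄ : s + tr = str) ξ η ζ,
    mul h₂ (mul h₁ ξ η) ζ = mul h₄ ξ (mul h₃ η ζ)

namespace ProductSystem

variable {n : ℕ} (P : ProductSystem.{u, v} M n) (R : HRep.{u, w} M)

/-- The correspondence `E_i`. -/
def fiber (i : Fin n) : WStarCorr.{u, v} M := P.X (Pi.single i 1)

variable {s t r : Fin n → ℕ} (h : s + t = r)

/-- The bilinear map `(η, x) ↦ ξη ⊗ x`. -/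
def mulBilin₁ (ξ : (P.X s).carrier) :
    (P.X t).carrier →ₗ[ℂ] R.space →ₗ[ℂ] TensSpace (P.X r) R :=
  (tmulₗ (P.X r) R).comp (P.mul h ξ)

theorem inner_mulBilin₁ (ξ ξ' : (P.X s).carrier) {k l : ℕ} (η : Fin k → (P.X t).carrier)
    (x : Fin k → R.space) (η' : Fin l → (P.X t).carrier) (x' : Fin l → R.space) :
    inner ℂ (∑ i, P.mulBilin₁ R h ξ (η i) (x i)) (∑ i, P.mulBilin₁ R h ξ' (η' i) (x' i)) =
      inner ℂ (∑ i, tmul (P.X t) R (η i) (x i))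
        (leftAct (P.X t) R ((P.X s).ip ξ ξ') (∑ i, tmul (P.X t) R (η' i) (x' i))) := by
  simp only [mulBilin₁, map_sum, leftAct_tmul, sum_inner, inner_sum, inner_tmul,
    LinearMap.comp_apply, tmulₗ_apply, P.ip_mul]

theorem mulBilin₁_bound (ξ : (P.X s).carrier) :
    ∃ C, TensBound (P.mulBilin₁ R h ξ) C := by
  obtain ⟨c, hc⟩ := CStarAlgebra.nonneg_iff_eq_star_mul_self.mp ((P.X s).ip_self_nonneg ξ)
  refine ⟨‖leftAct (P.X t) R c‖, norm_nonneg _, fun k η x => ?_⟩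
  refine le_trans (le_of_eq ?_) ((leftAct (P.X t) R c).le_opNorm _)
  refine (sq_eq_sq₀ (norm_nonneg _) (norm_nonneg _)).mp ?_
  rw [@norm_sq_eq_re_inner ℂ, @norm_sq_eq_re_inner ℂ, inner_mulBilin₁, hc]
  congr 1
  exact ((tens (P.X t) R).rep_star_rep c c _ _).symm

/-- The operator `η ⊗ x ↦ ξη ⊗ x`. -/
def mulOp (ξ : (P.X s).carrier) : TensSpace (P.X t) R →L[ℂ] TensSpace (P.X r) R :=
  tensLift (P.mulBilin₁ R h ξ)

theorem mulOp_tmul (ξ : (P.X s).carrier) (η : (P.X t).carrier) (x : R.space) :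
    P.mulOp R h ξ (tmul (P.X t) R η x) = tmul (P.X r) R (P.mul h ξ η) x :=
  tensLift_tmul (P.mulBilin₁_bound R h ξ).choose_spec η x

theorem inner_mulOp (ξ ξ' : (P.X s).carrier) (z z' : TensSpace (P.X t) R) :
    inner ℂ (P.mulOp R h ξ z) (P.mulOp R h ξ' z') =
      inner ℂ z (leftAct (P.X t) R ((P.X s).ip ξ ξ') z') := by
  refine tens_induction (P.X t) R (p := fun z => inner ℂ (P.mulOp R h ξ z) (P.mulOp R h ξ' z') =
    inner ℂ z (leftAct (P.X t) R ((P.X s).ip ξ ξ') z'))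
    (isClosed_eq (by fun_prop) (by fun_prop)) (fun k η x => ?_) z
  refine tens_induction (P.X t) R (p := fun z' => inner ℂ
    (P.mulOp R h ξ (∑ i, tmul (P.X t) R (η i) (x i))) (P.mulOp R h ξ' z') =
    inner ℂ (∑ i, tmul (P.X t) R (η i) (x i)) (leftAct (P.X t) R ((P.X s).ip ξ ξ') z'))
    (isClosed_eq (by fun_prop) (by fun_prop)) (fun l η' x' => ?_) z'
  rw [← inner_mulBilin₁ P R h, map_sum, map_sum]
  simp only [mulOp_tmul]
  rfl

/-- The bilinear map `(ξ, η ⊗ x) ↦ ξη ⊗ x`. -/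
def mulBilin : (P.X s).carrier →ₗ[ℂ] (tens (P.X t) R).space →ₗ[ℂ] TensSpace (P.X r) R :=
  LinearMap.mk₂ ℂ (fun ξ z => P.mulOp R h ξ z)
    (fun ξ₁ ξ₂ z => by
      have : P.mulOp R h (ξ₁ + ξ₂) = P.mulOp R h ξ₁ + P.mulOp R h ξ₂ := tens_ext fun η x => by
        simp [mulOp_tmul, add_tmul]
      rw [this]; rfl)
    (fun c ξ z => by
      have : P.mulOp R h (c • ξ) = c • P.mulOp R h ξ := tens_ext fun η x => by
        simp [mulOp_tmul, smul_tmul]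
      rw [this]; rfl)
    (fun ξ z₁ z₂ => map_add _ _ _)
    (fun c ξ z => map_smul _ _ _)

theorem mulBilin_bound : TensBound (P.mulBilin R h) 1 := by
  refine ⟨zero_le_one, fun k ξ z => ?_⟩
  rw [one_mul]
  refine (sq_le_sq₀ (norm_nonneg _) (norm_nonneg _)).mp (le_of_eq ?_)
  rw [norm_sq_sum_tmul, @norm_sq_eq_re_inner ℂ, sum_inner]
  simp only [inner_sum]
  refine congrArg Complex.re (Finset.sum_congr rfl fun i _ => Finset.sum_congr rfl fun j _ => ?_)
  exact P.inner_mulOp R h (ξ i) (ξ j) (z i) (z j)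

/-- The identification `X s ⊗ (X t ⊗ H) → X (s + t) ⊗ H`, `ξ ⊗ (η ⊗ x) ↦ ξη ⊗ x`. -/
def mulMap : Hom (tens (P.X s) (tens (P.X t) R)) (tens (P.X r) R) where
  op := tensLift (P.mulBilin R h)
  comm a z := by
    have h1 : ∀ ξ : (P.X s).carrier, P.mulOp R h (a • ξ) = leftAct (P.X r) R a ∘L P.mulOp R h ξ :=
      fun ξ => tens_ext fun η x => by simp [mulOp_tmul, P.smul_mul]
    have h2 : tensLift (P.mulBilin R h) ∘L leftAct (P.X s) (tens (P.X t) R) a =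
        leftAct (P.X r) R a ∘L tensLift (P.mulBilin R h) := tens_ext fun ξ z => by
      rw [ContinuousLinearMap.comp_apply, ContinuousLinearMap.comp_apply, leftAct_tmul,
        tensLift_tmul (P.mulBilin_bound R h), tensLift_tmul (P.mulBilin_bound R h)]
      exact DFunLike.congr_fun (h1 ξ) z
    exact DFunLike.congr_fun h2 z

theorem mulMap_tmul (ξ : (P.X s).carrier) (η : (P.X t).carrier) (x : R.space) :
    (P.mulMap R h).op (tmul (P.X s) (tens (P.X t) R) ξ (tmul (P.X t) R η x)) =
      tmul (P.X r) R (P.mul h ξ η) x :=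
  (tensLift_tmul (P.mulBilin_bound R h) ξ _).trans (P.mulOp_tmul R h ξ η x)

theorem norm_mulMap_le : ‖(P.mulMap R h).op‖ ≤ 1 :=
  norm_tensLift_le (P.mulBilin_bound R h)

/-- The identification `t ⊗ I : X s ⊗ (X t ⊗ H) → X t ⊗ (X s ⊗ H)` given by the product system. -/
def flip : Hom (tens (P.X s) (tens (P.X t) R)) (tens (P.X t) (tens (P.X s) R)) :=
  (P.mulMap R (add_comm t s))† ⊚ P.mulMap R rfl

theorem norm_flip_le : ‖(P.flip R (s := s) (t := t)).op‖ ≤ 1 := by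
  refine (ContinuousLinearMap.opNorm_comp_le _ _).trans ?_
  refine mul_le_one₀ ?_ (norm_nonneg _) (P.norm_mulMap_le R _)
  exact (LinearIsometryEquiv.norm_map ContinuousLinearMap.adjoint _).le.trans
    (P.norm_mulMap_le R _)

end ProductSystem

end ProductSystems

section DirectSums

variable {M : Type u} [CStarAlgebra M]

/-- The restriction of a representation to a closed invariant subspace. -/
def HRep.sub (R : HRep.{u, w} M) (K : Submodule ℂ R.space) (hK : IsClosed (K : Set R.space))
    (hinv : ∀ a : M, ∀ x ∈ K, R.rep a x ∈ K) : HRep.{u, w} M where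
  space := K
  completeSpace := hK.completeSpace_coe
  rep :=
    { toFun := fun a => ((R.rep a) ∘L K.subtypeL).codRestrict K fun x => hinv a x x.2
      map_one' := ContinuousLinearMap.ext fun x =>
        Subtype.ext (DFunLike.congr_fun (map_one R.rep) x.1)
      map_mul' := fun a b => ContinuousLinearMap.ext fun x =>
        Subtype.ext (DFunLike.congr_fun (map_mul R.rep a b) x.1)
      map_zero' := ContinuousLinearMap.ext fun x =>
        Subtype.ext (DFunLike.congr_fun (map_zero R.rep) x.1)
      map_add' := fun a b => ContinuousLinearMap.ext fun x =>
        Subtype.ext (DFunLike.congr_fun (map_add R.rep a b) x.1)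
      commutes' := fun c => ContinuousLinearMap.ext fun x =>
        Subtype.ext (DFunLike.congr_fun (AlgHomClass.commutes R.rep c) x.1)
      map_star' := fun a => by
        have := hK.completeSpace_coe
        rw [ContinuousLinearMap.star_eq_adjoint, ContinuousLinearMap.eq_adjoint_iff]
        intro x y
        rw [Submodule.coe_inner, Submodule.coe_inner]
        exact (R.inner_rep_left (star a) x y).trans (by rw [star_star]; rfl) }

/-- The subrepresentation on the closure of the range of an intertwiner. -/
def rangeRep {R : HRep.{u, w} M} {S : HRep.{u, w₁} M} (D : Hom R S) : HRep.{u, w₁} M :=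
  S.sub D.op.range.topologicalClosure (Submodule.isClosed_topologicalClosure _) fun a x hx => by
    refine map_mem_closure (S.rep a).continuous hx fun y hy => ?_
    obtain ⟨z, rfl⟩ := hy
    exact ⟨R.rep a z, D.comm a z⟩

/-- The intertwiner `D`, as a map into the closure of its range. -/
def toRangeRep {R : HRep.{u, w} M} {S : HRep.{u, w₁} M} (D : Hom R S) : Hom R (rangeRep D) where
  op := D.op.codRestrict D.op.range.topologicalClosure fun x =>
    Submodule.le_topologicalClosure _ ⟨x, rfl⟩
  comm a x := Subtype.ext (D.comm a x)

section Binary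

/-- The direct sum of two operators. -/
def prodOp {H₁ H₂ K₁ K₂ : Type*} [NormedAddCommGroup H₁] [NormedAddCommGroup H₂]
    [NormedAddCommGroup K₁] [NormedAddCommGroup K₂] [NormedSpace ℂ H₁] [NormedSpace ℂ H₂]
    [NormedSpace ℂ K₁] [NormedSpace ℂ K₂] (f : H₁ →L[ℂ] K₁) (g : H₂ →L[ℂ] K₂) :
    WithLp 2 (H₁ × H₂) →L[ℂ] WithLp 2 (K₁ × K₂) :=
  (WithLp.prodContinuousLinearEquiv 2 ℂ K₁ K₂).symm.toContinuousLinearMap ∘L f.prodMap g ∘L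
    (WithLp.prodContinuousLinearEquiv 2 ℂ H₁ H₂).toContinuousLinearMap

/-- The direct sum of two representations. -/
def HRep.sum (R : HRep.{u, w} M) (S : HRep.{u, w₁} M) : HRep.{u, max w w₁} M where
  space := WithLp 2 (R.space × S.space)
  rep :=
    { toFun := fun a => prodOp (R.rep a) (S.rep a)
      map_one' := ContinuousLinearMap.ext fun x => congrArg (WithLp.toLp 2) (Prod.ext
        (DFunLike.congr_fun (map_one R.rep) x.fst) (DFunLike.congr_fun (map_one S.rep) x.snd))
      map_mul' := fun a b => ContinuousLinearMap.ext fun x => congrArg (WithLp.toLp 2) (Prod.ext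
        (DFunLike.congr_fun (map_mul R.rep a b) x.fst)
        (DFunLike.congr_fun (map_mul S.rep a b) x.snd))
      map_zero' := ContinuousLinearMap.ext fun x => congrArg (WithLp.toLp 2) (Prod.ext
        (DFunLike.congr_fun (map_zero R.rep) x.fst) (DFunLike.congr_fun (map_zero S.rep) x.snd))
      map_add' := fun a b => ContinuousLinearMap.ext fun x => congrArg (WithLp.toLp 2) (Prod.ext
        (DFunLike.congr_fun (map_add R.rep a b) x.fst)
        (DFunLike.congr_fun (map_add S.rep a b) x.snd))
      commutes' := fun c => ContinuousLinearMap.ext fun x => congrArg (WithLp.toLp 2) (Prod.ext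
        (DFunLike.congr_fun (AlgHomClass.commutes R.rep c) x.fst)
        (DFunLike.congr_fun (AlgHomClass.commutes S.rep c) x.snd))
      map_star' := fun a => by
        rw [ContinuousLinearMap.star_eq_adjoint, ContinuousLinearMap.eq_adjoint_iff]
        intro x y
        rw [WithLp.prod_inner_apply, WithLp.prod_inner_apply]
        exact congrArg₂ (· + ·) ((R.inner_rep_left (star a) _ _).trans (by rw [star_star]; rfl))
          ((S.inner_rep_left (star a) _ _).trans (by rw [star_star]; rfl)) }

variable (R : HRep.{u, w} M) (S : HRep.{u, w₁} M)

/-- The projection onto the first summand. -/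
def Hom.fst : Hom (R.sum S) R where
  op := WithLp.fstL 2 ℂ R.space S.space
  comm _ _ := rfl

/-- The projection onto the second summand. -/
def Hom.snd : Hom (R.sum S) S where
  op := WithLp.sndL 2 ℂ R.space S.space
  comm _ _ := rfl

/-- The inclusion of the first summand. -/
def Hom.inl : Hom R (R.sum S) where
  op := (WithLp.prodContinuousLinearEquiv 2 ℂ R.space S.space).symm.toContinuousLinearMap ∘L
    ContinuousLinearMap.inl ℂ R.space S.space
  comm a _ := congrArg (WithLp.toLp 2) (Prod.ext rfl (map_zero (S.rep a)).symm)

/-- The inclusion of the second summand. -/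
def Hom.inr : Hom S (R.sum S) where
  op := (WithLp.prodContinuousLinearEquiv 2 ℂ R.space S.space).symm.toContinuousLinearMap ∘L
    ContinuousLinearMap.inr ℂ R.space S.space
  comm a _ := congrArg (WithLp.toLp 2) (Prod.ext (map_zero (R.rep a)).symm rfl)

variable {R S}

/-- The operator with the block matrix `(a, b; c, d)`. -/
def Hom.block {R' : HRep.{u, w₂} M} {S' : HRep.{u, v} M} (a : Hom R R') (b : Hom S R')
    (c : Hom R S') (d : Hom S S') : Hom (R.sum S) (R'.sum S') :=
  (Hom.inl R' S' ⊚ (a ⊚ Hom.fst R S + b ⊚ Hom.snd R S)) +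
    (Hom.inr R' S' ⊚ (c ⊚ Hom.fst R S + d ⊚ Hom.snd R S))

end Binary

section Infinite

variable {ι : Type} {X : Type w} [NormedAddCommGroup X] [InnerProductSpace ℂ X]

/-- The operator into an `ℓ²`-direct sum with the components `g i`. -/
def lpLift (G : ι → Type w₁) [∀ i, NormedAddCommGroup (G i)] [∀ i, InnerProductSpace ℂ (G i)]
    (g : ∀ i, X →L[ℂ] G i) (C : ℝ) (hC : 0 ≤ C)
    (h : ∀ (x : X) (s : Finset ι), ∑ i ∈ s, ‖g i x‖ ^ 2 ≤ (C * ‖x‖) ^ 2) : X →L[ℂ] lp G 2 :=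
  LinearMap.mkContinuous
    { toFun := fun x => ⟨fun i => g i x, memℓp_gen' (C := (C * ‖x‖) ^ 2) fun s => by
        simpa using h x s⟩
      map_add' := fun x y => Subtype.ext <| funext fun i => map_add (g i) x y
      map_smul' := fun c x => Subtype.ext <| funext fun i => map_smul (g i) c x } C fun x =>
    lp.norm_le_of_forall_sum_le (by norm_num) (by positivity) fun s => by simpa using h x s

variable (F : ι → HRep.{u, w} M)

theorem lp_sum_sq_le (z : lp (fun i => (F i).space) 2) (s : Finset ι) :
    ∑ i ∈ s, ‖z i‖ ^ 2 ≤ ‖z‖ ^ 2 := by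
  simpa using lp.sum_rpow_le_norm_rpow (p := 2) (by norm_num) z s

theorem pull_bound {κ : Type} (φ : κ → ι) (hφ : Function.Injective φ) {G : κ → Type w₁}
    [∀ i, NormedAddCommGroup (G i)] [∀ i, InnerProductSpace ℂ (G i)]
    (f : ∀ i, (F (φ i)).space →L[ℂ] G i) (C : ℝ) (h : ∀ i, ‖f i‖ ≤ C)
    (z : lp (fun i => (F i).space) 2) (s : Finset κ) :
    ∑ i ∈ s, ‖f i (z (φ i))‖ ^ 2 ≤ (C * ‖z‖) ^ 2 := by
  calc ∑ i ∈ s, ‖f i (z (φ i))‖ ^ 2 ≤ ∑ i ∈ s, C ^ 2 * ‖z (φ i)‖ ^ 2 :=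
        Finset.sum_le_sum fun i _ => by
          rw [← mul_pow]
          exact pow_le_pow_left₀ (norm_nonneg _) ((f i).le_of_opNorm_le (h i) _) 2
    _ = C ^ 2 * ∑ i ∈ s.map ⟨φ, hφ⟩, ‖z i‖ ^ 2 := by rw [Finset.sum_map, Finset.mul_sum]; rfl
    _ ≤ (C * ‖z‖) ^ 2 := by
        rw [mul_pow]
        exact mul_le_mul_of_nonneg_left (lp_sum_sq_le F z _) (sq_nonneg C)

/-- The operator `z ↦ (f i (z (φ i)))` between `ℓ²`-direct sums. -/
def pullOp {κ : Type} (φ : κ → ι) (hφ : Function.Injective φ) (G : κ → Type w₁)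
    [∀ i, NormedAddCommGroup (G i)] [∀ i, InnerProductSpace ℂ (G i)]
    (f : ∀ i, (F (φ i)).space →L[ℂ] G i) (C : ℝ) (hC : 0 ≤ C) (h : ∀ i, ‖f i‖ ≤ C) :
    lp (fun i => (F i).space) 2 →L[ℂ] lp G 2 :=
  lpLift G (fun i => f i ∘L lp.evalCLM ℂ (fun i => (F i).space) 2 (φ i)) C hC fun z s =>
    pull_bound F φ hφ f C h z s

/-- The `ℓ²`-direct sum of representations. -/
def lpSum : HRep.{u, w} M where
  space := lp (fun i => (F i).space) 2
  rep :=
    { toFun := fun a => pullOp F id Function.injective_id _ (fun i => (F i).rep a) ‖a‖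
        (norm_nonneg a) fun i => NonUnitalStarAlgHom.norm_apply_le ((F i).rep) a
      map_one' := ContinuousLinearMap.ext fun z => Subtype.ext <| funext fun i =>
        DFunLike.congr_fun (map_one (F i).rep) (z i)
      map_mul' := fun a b => ContinuousLinearMap.ext fun z => Subtype.ext <| funext fun i =>
        DFunLike.congr_fun (map_mul (F i).rep a b) (z i)
      map_zero' := ContinuousLinearMap.ext fun z => Subtype.ext <| funext fun i =>
        DFunLike.congr_fun (map_zero (F i).rep) (z i)
      map_add' := fun a b => ContinuousLinearMap.ext fun z => Subtype.ext <| funext fun i =>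
        DFunLike.congr_fun (map_add (F i).rep a b) (z i)
      commutes' := fun c => ContinuousLinearMap.ext fun z => Subtype.ext <| funext fun i =>
        DFunLike.congr_fun (AlgHomClass.commutes (F i).rep c) (z i)
      map_star' := fun a => by
        rw [ContinuousLinearMap.star_eq_adjoint, ContinuousLinearMap.eq_adjoint_iff]
        intro x y
        rw [lp.inner_eq_tsum, lp.inner_eq_tsum]
        refine tsum_congr fun i => ?_
        exact ((F i).inner_rep_left (star a) _ _).trans (by rw [star_star]; rfl) }

/-- The intertwiner `z ↦ (f i (z (φ i)))` between direct sums. -/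
def Hom.pull {κ : Type} (φ : κ → ι) (hφ : Function.Injective φ) {F : ι → HRep.{u, w} M}
    {G : κ → HRep.{u, w₁} M} (f : ∀ i, Hom (F (φ i)) (G i)) (C : ℝ) (hC : 0 ≤ C)
    (h : ∀ i, ‖(f i).op‖ ≤ C) : Hom (lpSum F) (lpSum G) where
  op := pullOp F φ hφ (fun i => (G i).space) (fun i => (f i).op) C hC h
  comm a z := by
    refine Subtype.ext (funext fun i => ?_)
    exact (f i).comm a _

/-- The intertwiner that maps the summand `G i` into the summand `F (φ i)` by `f i`. -/
def Hom.shift {κ : Type} (φ : κ → ι) (hφ : Function.Injective φ) {F : ι → HRep.{u, w} M}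
    {G : κ → HRep.{u, w₁} M} (f : ∀ i, Hom (G i) (F (φ i))) (C : ℝ) (hC : 0 ≤ C)
    (h : ∀ i, ‖(f i).op‖ ≤ C) : Hom (lpSum G) (lpSum F) :=
  (Hom.pull φ hφ (fun i => (f i)†) C hC fun i =>
    (LinearIsometryEquiv.norm_map ContinuousLinearMap.adjoint (f i).op).le.trans (h i))†

/-- The projection onto a summand. -/
def lpProj (i : ι) : Hom (lpSum F) (F i) where
  op := lp.evalCLM ℂ (fun i => (F i).space) 2 i
  comm _ _ := rfl

/-- The operator `shift φ f` maps the summand `G i` into the summand `F (φ i)` by `f i`; here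
`(lpProj G i)†` is the inclusion of the summand `G i`. -/
theorem Hom.shift_incl {κ : Type} (φ : κ → ι) (hφ : Function.Injective φ) {F : ι → HRep.{u, w} M}
    {G : κ → HRep.{u, w₁} M} (f : ∀ i, Hom (G i) (F (φ i))) (C : ℝ) (hC : 0 ≤ C)
    (h : ∀ i, ‖(f i).op‖ ≤ C) (i : κ) :
    Hom.shift φ hφ f C hC h ⊚ (lpProj G i)† = (lpProj F (φ i))† ⊚ f i := by
  apply Hom.ext
  refine (ContinuousLinearMap.adjoint_comp (lpProj G i).op _).symm.trans ?_
  refine (ContinuousLinearMap.adjoint_comp (f i)†.op (lpProj F (φ i)).op).trans ?_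
  exact congrArg (fun g => (lpProj F (φ i))†.op ∘L g)
    (ContinuousLinearMap.adjoint_adjoint (f i).op)

end Infinite

end DirectSums

section Distribute

variable {M : Type u} [CStarAlgebra M] [PartialOrder M] [StarOrderedRing M]

theorem tmap_sum_tmul {R : HRep.{u, w} M} {S : HRep.{u, w₁} M} (E : WStarCorr.{u, v} M)
    (f : Hom R S) {k : ℕ} (ξ : Fin k → E.carrier) (h : Fin k → R.space) :
    (tmap E f).op (∑ j, tmul E R (ξ j) (h j)) = ∑ j, tmul E S (ξ j) (f.op (h j)) := by
  refine (map_sum (tensLift (tmapBilin E f)) _ _).trans (Finset.sum_congr rfl fun j _ => ?_)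
  exact tmap_tmul E f (ξ j) (h j)

theorem dist_bound (E : WStarCorr.{u, v} M) {ι : Type} (F : ι → HRep.{u, w} M)
    (z : TensSpace E (lpSum F)) (s : Finset ι) :
    ∑ i ∈ s, ‖(tmap E (lpProj F i)).op z‖ ^ 2 ≤ (1 * ‖z‖) ^ 2 := by
  rw [one_mul]
  refine tens_induction E (lpSum F)
    (p := fun z => ∑ i ∈ s, ‖(tmap E (lpProj F i)).op z‖ ^ 2 ≤ ‖z‖ ^ 2)
    (isClosed_le (by fun_prop) (by fun_prop)) (fun k ξ h => ?_) z
  obtain ⟨B, hB⟩ := E.exists_gram_factor ξ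
  have h1 : ∀ i, ‖(tmap E (lpProj F i)).op (∑ j, tmul E (lpSum F) (ξ j) (h j))‖ ^ 2 =
      ∑ l, ‖(lpProj F i).op (∑ j, (lpSum F).rep (B l j) (h j))‖ ^ 2 := fun i => by
    rw [tmap_sum_tmul]
    refine (norm_sq_factor E (F i) ξ B hB _).trans (Finset.sum_congr rfl fun l _ => ?_)
    rw [map_sum]
    simp only [(lpProj F i).comm]
  refine (Finset.sum_congr rfl fun i _ => h1 i).trans_le ?_
  rw [Finset.sum_comm, norm_sq_factor E (lpSum F) ξ B hB]
  exact Finset.sum_le_sum fun l _ => lp_sum_sq_le F _ s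

/-- The identification of `E ⊗ (⨁ F i)` with `⨁ (E ⊗ F i)`. -/
def dist (E : WStarCorr.{u, v} M) {ι : Type} (F : ι → HRep.{u, w} M) :
    Hom (tens E (lpSum F)) (lpSum fun i => tens E (F i)) where
  op := lpLift (fun i => (tens E (F i)).space) (fun i => (tmap E (lpProj F i)).op) 1 zero_le_one
    (dist_bound E F)
  comm a z := Subtype.ext (funext fun i => (tmap E (lpProj F i)).comm a z)

end Distribute

section Representations

variable {M : Type u} [CStarAlgebra M] [PartialOrder M] [StarOrderedRing M]

/-- A completely contractive representation `(σ, T_1, …, T_n)` of a product system, where `σ` is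
the given representation `R`, assumed to be normal. -/
structure PSRep {n : ℕ} (P : ProductSystem.{u, v} M n) (R : HRep.{u, v} M) where
  normal : R.IsNormal
  T : ∀ i, CCRep (P.fiber i) R
  commute : ∀ i j, (T i).tilde ⊚ tmap (P.fiber i) (T j).tilde =
    (T j).tilde ⊚ tmap (P.fiber j) (T i).tilde ⊚ P.flip R (s := Pi.single i 1) (t := Pi.single j 1)

/-- The space `E_{i_1} ⊗ (E_{i_2} ⊗ ⋯ ⊗ H)` for the list of indices `i_1, i_2, …`. -/
def tensList {n : ℕ} (P : ProductSystem.{u, v} M n) (R : HRep.{u, v} M) :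
    List (Fin n) → HRep.{u, v} M
  | [] => R
  | i :: L => tens (P.fiber i) (tensList P R L)

namespace PSRep

variable {n : ℕ} {P : ProductSystem.{u, v} M n} {R : HRep.{u, v} M} (τ : PSRep P R)

/-- The operator `T̃_i` on `E_i ⊗ H`. -/
def tilde (i : Fin n) : Hom (tens (P.fiber i) R) R := (τ.T i).tilde

/-- The operator `T̃_{i_1} (I ⊗ T̃_{i_2}) ⋯ (I ⊗ T̃_{i_k})`. -/
def tildeList : ∀ L : List (Fin n), Hom (tensList P R L) R
  | [] => Hom.id R
  | i :: L => τ.tilde i ⊚ tmap (P.fiber i) (tildeList L)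

/-- The operator `∑_{G ⊆ A} (-1)^{|G|} T̃_G T̃_G*` for a set `A` of indices. -/
def szego (A : Finset (Fin n)) : R.space →L[ℂ] R.space :=
  ∑ G ∈ A.powerset, (-1 : ℂ) ^ G.card •
    (τ.tildeList (G.sort (· ≤ ·)) ⊚ (τ.tildeList (G.sort (· ≤ ·)))†).op

theorem commute_szego (A : Finset (Fin n)) (a : M) : Commute (τ.szego A) (R.rep a) := by
  unfold szego
  refine Commute.sum_left _ _ _ fun G _ => Commute.smul_left ?_ _
  ext x
  exact (τ.tildeList (G.sort (· ≤ ·)) ⊚ (τ.tildeList (G.sort (· ≤ ·)))†).comm a x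

/-- The defect operator: the positive square root of the operator `szego A`. -/
def defect (A : Finset (Fin n)) : Hom R R where
  op := CFC.sqrt (τ.szego A)
  comm a x := DFunLike.congr_fun ((τ.commute_szego A a).cfcₙ_nnreal NNReal.sqrt) x

/-- The representation of `E_i` is pure: `T̃_i^{(k)} T̃_i^{(k)*} → 0` in the weak operator
topology. -/
def IsPure (i : Fin n) : Prop :=
  ∀ x y : R.space, Filter.Tendsto (fun k : ℕ => inner ℂ x
    ((τ.tildeList (List.replicate k i) ⊚ (τ.tildeList (List.replicate k i))†).op y))
    Filter.atTop (nhds 0)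

end PSRep

end Representations

section Construction

variable {M : Type u} [CStarAlgebra M] [PartialOrder M] [StarOrderedRing M]

namespace PSRep

variable {m : ℕ} {P : ProductSystem.{u, v} M (m + 2)} {R : HRep.{u, v} M} (τ : PSRep P R)

/-- The class of those representations `(σ, T_1, …, T_n)`, `n = m + 2`, for which the two tuples
obtained by omitting `T_1` and by omitting `T_n` satisfy Szegö positivity, and the tuple obtained
by omitting `T_n` is pure. -/
structure MemClass : Prop where
  szego_omit_first : (τ.szego (Finset.univ.erase 0)).IsPositive
  szego_omit_last : (τ.szego (Finset.univ.erase (Fin.last (m + 1)))).IsPositive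
  pure_omit_last : ∀ i, i ≠ Fin.last (m + 1) → τ.IsPure i

/-- The defect operator of the tuple obtained by omitting `T_1`, onto its range closure. -/
def D₁ : Hom R (rangeRep (τ.defect (Finset.univ.erase 0))) := toRangeRep _

/-- The defect operator of the tuple obtained by omitting `T_n`, onto its range closure. -/
def Dₙ : Hom R (rangeRep (τ.defect (Finset.univ.erase (Fin.last (m + 1))))) := toRangeRep _

/-- The defect space of the tuple obtained by omitting `T_1`. -/
abbrev defectSpace₁ : HRep.{u, v} M := rangeRep (τ.defect (Finset.univ.erase 0))

/-- The defect space of the tuple obtained by omitting `T_n`. -/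
abbrev defectSpaceₙ : HRep.{u, v} M :=
  rangeRep (τ.defect (Finset.univ.erase (Fin.last (m + 1))))

end PSRep

namespace ProductSystem

variable {m : ℕ} (P : ProductSystem.{u, v} M (m + 2))

/-- The first correspondence. -/
abbrev E₁ : WStarCorr.{u, v} M := P.fiber 0

/-- The last correspondence. -/
abbrev Eₙ : WStarCorr.{u, v} M := P.fiber (Fin.last (m + 1))

/-- The sum of the first and the last unit vector. -/
def e₁ₙ (m : ℕ) : Fin (m + 2) → ℕ := Pi.single 0 1 + Pi.single (Fin.last (m + 1)) 1

/-- The correspondence `E_1 ⊗ E_n`. -/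
abbrev E₁ₙ : WStarCorr.{u, v} M := P.X (e₁ₙ m)

variable (R : HRep.{u, v} M)

/-- The identification `E_1 ⊗ E_n ⊗ H = E_{1n} ⊗ H`. -/
def mul₁ₙ : Hom (tens P.E₁ (tens P.Eₙ R)) (tens P.E₁ₙ R) := P.mulMap R rfl

/-- The identification `E_n ⊗ E_1 ⊗ H = E_{1n} ⊗ H`. -/
def mulₙ₁ : Hom (tens P.Eₙ (tens P.E₁ R)) (tens P.E₁ₙ R) := P.mulMap R (add_comm _ _)

/-- The exponent `(α_1, …, α_{n-1}, α_1)`: the correspondence with this exponent is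
`E^α = E_{1n}^{α_1} ⊗ E_2^{α_2} ⊗ ⋯ ⊗ E_{n-1}^{α_{n-1}}`. -/
def expo (α : Fin (m + 1) → ℕ) : Fin (m + 2) → ℕ := Fin.snoc (α := fun _ => ℕ) α (α 0)

theorem expo_add (α β : Fin (m + 1) → ℕ) : expo (α + β) = expo α + expo β := by
  funext i
  refine Fin.lastCases ?_ (fun j => ?_) i <;> simp [expo]

theorem expo_single : expo (Pi.single 0 1) = e₁ₙ m := by
  funext i
  refine Fin.lastCases ?_ (fun j => ?_) i
  · simp [expo, e₁ₙ]
  · by_cases hj : j = 0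
    · subst hj; simp [expo, e₁ₙ]
    · simp [expo, e₁ₙ, hj, (Fin.castSucc_lt_last j).ne]

/-- The Hilbert space `F(E) ⊗ H = ⨁_α E^α ⊗ H`, where `α` runs over `ℕ^{n-1}`. -/
def fock : HRep.{u, v} M := lpSum fun α : Fin (m + 1) → ℕ => tens (P.X (expo α)) R

variable {R}

/-- The operator `I_{F(E)} ⊗ f`. -/
def fockMap {S : HRep.{u, v} M} (f : Hom R S) : Hom (P.fock R) (P.fock S) :=
  Hom.pull (F := fun α : Fin (m + 1) → ℕ => tens (P.X (expo α)) R) id Function.injective_id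
    (fun α => tmap (P.X (expo α)) f) ‖f.op‖ (norm_nonneg _) fun _ => norm_tmap_le _ f

variable (R)

/-- The identification of `E_i ⊗ F(E) ⊗ H` with `F(E) ⊗ E_i ⊗ H` given by the product system. -/
def fockFlip (i : Fin (m + 2)) :
    Hom (tens (P.fiber i) (P.fock R)) (P.fock (tens (P.fiber i) R)) :=
  Hom.pull (F := fun α : Fin (m + 1) → ℕ => tens (P.fiber i) (tens (P.X (expo α)) R)) id
    Function.injective_id (fun α => P.flip R (s := Pi.single i 1) (t := expo α)) 1 zero_le_one
    (fun _ => P.norm_flip_le R) ⊚ dist (P.fiber i) fun α => tens (P.X (expo α)) R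

/-- The embedding of `F(E) ⊗ E_{1n} ⊗ H` into `F(E) ⊗ H`. -/
def absorb : Hom (P.fock (tens P.E₁ₙ R)) (P.fock R) :=
  Hom.shift (F := fun α : Fin (m + 1) → ℕ => tens (P.X (expo α)) R)
    (fun α => α + Pi.single 0 1) (add_left_injective _)
    (fun α => P.mulMap R (by rw [expo_add, expo_single])) 1 zero_le_one
    fun _ => P.norm_mulMap_le R _

/-- The left creation operator `L̃_1 : E_{1n} ⊗ F(E) ⊗ H → F(E) ⊗ H`, `L̃_1(ξ ⊗ k) = ξ ⊗ k`. -/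
def creation : Hom (tens P.E₁ₙ (P.fock R)) (P.fock R) :=
  Hom.shift (F := fun α : Fin (m + 1) → ℕ => tens (P.X (expo α)) R)
    (fun α => α + Pi.single 0 1) (add_left_injective _)
    (fun α => P.mulMap R (by rw [expo_add, expo_single]; exact add_comm _ _)) 1 zero_le_one
    (fun _ => P.norm_mulMap_le R _) ⊚ dist P.E₁ₙ fun α => tens (P.X (expo α)) R

variable {R}

/-- For `V = (A, B; C, 0) : D ⊕ (E_{1n} ⊗ D') → (E_i ⊗ D) ⊕ D'`, the operator
`τ_{V*} = I_{F(E)} ⊗ (A* + (I_{1n} ⊗ C*) B*)` from `E_i ⊗ F(E) ⊗ D = F(E) ⊗ E_i ⊗ D` to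
`F(E) ⊗ D`, where `F(E) ⊗ E_{1n} ⊗ D` is embedded in `F(E) ⊗ D`. -/
def transfer (i : Fin (m + 2)) {R' : HRep.{u, v} M}
    (V : Hom (R.sum (tens P.E₁ₙ R')) ((tens (P.fiber i) R).sum R')) :
    Hom (tens (P.fiber i) (P.fock R)) (P.fock R) :=
  let A : Hom R (tens (P.fiber i) R) := Hom.fst _ _ ⊚ V ⊚ Hom.inl _ _
  let B : Hom (tens P.E₁ₙ R') (tens (P.fiber i) R) := Hom.fst _ _ ⊚ V ⊚ Hom.inr _ _
  let C : Hom R R' := Hom.snd _ _ ⊚ V ⊚ Hom.inl _ _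
  (P.fockMap (A†) + P.absorb R ⊚ P.fockMap (tmap P.E₁ₙ (C†) ⊚ (B†))) ⊚ P.fockFlip R i

end ProductSystem

namespace PSRep

variable {m : ℕ} {P : ProductSystem.{u, v} M (m + 2)} {R : HRep.{u, v} M} (τ : PSRep P R)
variable (ℰ₁ ℰ₂ : HRep.{u, v} M)

/-- The space `𝒟 = 𝒟_{T̂_n} ⊕ (E_1 ⊗ 𝒟_{T̂_1}) ⊕ ℰ_1`. -/
abbrev bigD : HRep.{u, v} M := τ.defectSpaceₙ.sum ((tens P.E₁ τ.defectSpace₁).sum ℰ₁)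

/-- The space `𝒟' = 𝒟_{T̂_n} ⊕ ℰ_1`. -/
abbrev bigD' : HRep.{u, v} M := τ.defectSpaceₙ.sum ℰ₁

/-- The space `𝒟_{T̂_1} ⊕ (E_n ⊗ 𝒟_{T̂_n}) ⊕ ℰ_2`. -/
abbrev domU : HRep.{u, v} M := τ.defectSpace₁.sum ((tens P.Eₙ τ.defectSpaceₙ).sum ℰ₂)

variable {ℰ₁ ℰ₂}

/-- `U (D_{T̂_1} h ⊕ (I_n ⊗ D_{T̂_n}) T̃_n* h ⊕ 0) = D_{T̂_n} h ⊕ (I_1 ⊗ D_{T̂_1}) T̃_1* h ⊕ 0`. -/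
def ExtendsU₀ (U : Hom (τ.domU ℰ₂) (τ.bigD ℰ₁)) : Prop :=
  U ⊚ (Hom.inl _ _ ⊚ τ.D₁ +
      Hom.inr _ _ ⊚ Hom.inl _ _ ⊚ tmap P.Eₙ τ.Dₙ ⊚ (τ.tilde (Fin.last (m + 1)))†) =
    Hom.inl _ _ ⊚ τ.Dₙ + Hom.inr _ _ ⊚ Hom.inl _ _ ⊚ tmap P.E₁ τ.D₁ ⊚ (τ.tilde 0)†

/-- The operator
`U_1 = ((I_1 ⊗ U) P_1, (I_1 ⊗ U) j_2'; i_2*, 0) : 𝒟 ⊕ (E_{1n} ⊗ 𝒟') → (E_1 ⊗ 𝒟) ⊕ 𝒟'`. -/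
def U₁ (U : Hom (τ.domU ℰ₂) (τ.bigD ℰ₁)) (u₂ : Hom ℰ₂ (tens P.Eₙ ℰ₁)) :
    Hom ((τ.bigD ℰ₁).sum (tens P.E₁ₙ (τ.bigD' ℰ₁))) ((tens P.E₁ (τ.bigD ℰ₁)).sum (τ.bigD' ℰ₁)) :=
  let P₁ : Hom (τ.bigD ℰ₁) (tens P.E₁ (τ.domU ℰ₂)) :=
    tmap P.E₁ (Hom.inl _ _) ⊚ Hom.fst _ _ ⊚ Hom.snd _ _
  let j₂ : Hom (tens P.E₁ₙ (τ.bigD' ℰ₁)) (tens P.E₁ (τ.domU ℰ₂)) :=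
    tmap P.E₁ (Hom.inr _ _ ⊚ Hom.inl _ _) ⊚ (P.mul₁ₙ _)† ⊚ tmap P.E₁ₙ (Hom.fst _ _) +
      tmap P.E₁ (Hom.inr _ _ ⊚ Hom.inr _ _ ⊚ u₂†) ⊚ (P.mul₁ₙ _)† ⊚ tmap P.E₁ₙ (Hom.snd _ _)
  let i₂ : Hom (τ.bigD' ℰ₁) (τ.bigD ℰ₁) :=
    Hom.inl _ _ ⊚ Hom.fst _ _ + Hom.inr _ _ ⊚ Hom.inr _ _ ⊚ Hom.snd _ _
  Hom.block (tmap P.E₁ U ⊚ P₁) (tmap P.E₁ U ⊚ j₂) (i₂†) 0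

/-- The operator `U_n = ((I ⊕ u_2) P_2 U*, i_1'; i_1* U*, 0)` from `𝒟 ⊕ (E_{1n} ⊗ 𝒟_{T̂_1})` to
`(E_n ⊗ 𝒟) ⊕ 𝒟_{T̂_1}`. -/
def Uₙ (U : Hom (τ.domU ℰ₂) (τ.bigD ℰ₁)) (u₂ : Hom ℰ₂ (tens P.Eₙ ℰ₁)) :
    Hom ((τ.bigD ℰ₁).sum (tens P.E₁ₙ τ.defectSpace₁))
      ((tens P.Eₙ (τ.bigD ℰ₁)).sum τ.defectSpace₁) :=
  let Q₂ : Hom (τ.domU ℰ₂) (tens P.Eₙ (τ.bigD ℰ₁)) :=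
    tmap P.Eₙ (Hom.inl _ _) ⊚ Hom.fst _ _ ⊚ Hom.snd _ _ +
      tmap P.Eₙ (Hom.inr _ _ ⊚ Hom.inr _ _) ⊚ u₂ ⊚ Hom.snd _ _ ⊚ Hom.snd _ _
  let i₁' : Hom (tens P.E₁ₙ τ.defectSpace₁) (tens P.Eₙ (τ.bigD ℰ₁)) :=
    tmap P.Eₙ (Hom.inr _ _ ⊚ Hom.inl _ _) ⊚ (P.mulₙ₁ _)†
  let i₁ : Hom τ.defectSpace₁ (τ.domU ℰ₂) := Hom.inl _ _
  Hom.block (Q₂ ⊚ U†) i₁' (i₁† ⊚ U†) 0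

end PSRep

end Construction

end CorrDil

end

/-!
Both operators `τ_{U_i*}` are of the form `I_{F(E)} ⊗ (a_i + b_i)` with `a_i : E_i ⊗ 𝒟 → 𝒟` and
`b_i : E_i ⊗ 𝒟 → E_{1n} ⊗ 𝒟`, preceded by the flip of `E_i` past `F(E)`. Hence their product is
governed by the three components of `(a₁ + b₁) (I ⊗ (aₙ + bₙ))` on `E₁ ⊗ Eₙ ⊗ 𝒟`, with values in
`𝒟`, in `E_{1n} ⊗ 𝒟` and in `E_{1n} ⊗ E_{1n} ⊗ 𝒟`. If they are `0`, the identification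
`E₁ ⊗ Eₙ ⊗ 𝒟 = E_{1n} ⊗ 𝒟` and `0`, then the product is the creation operator
(`ProductSystem.fockExt_comp_tmap_fockExt`).

The three components are computed from the block matrices. In each of them `U* U = 1` cancels. The
first vanishes since `I ⊗ P₂` annihilates the range `E₁ ⊗ 𝒟_{T̂_1}` of `P₁`, the third since `I ⊗ i₁`
and `j₂'` have orthogonal ranges. In the second, `b₁ (I ⊗ aₙ)` is the identification on the summands
over `𝒟_{T̂_n}` and `ℰ₁` (here `u₂ u₂* = 1` is used), and `(I ⊗ a₁) (I ⊗ bₙ)` is the identification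
on the summand over `E₁ ⊗ 𝒟_{T̂_1}` (`ProductSystem.coeff_sum`).

The passage to the Fock space needs the flips to be compatible with the multiplication, and for this
the isometries `X s ⊗ (X t ⊗ H) → X (s + t) ⊗ H` have to be onto. The products `ξη` are only
ultraweakly total in `X (s + t)`, so that this requires `H` to be normal
(`ProductSystem.mulMap_comp_adj`): then the functionals `ζ ↦ ⟨y, ζ ⊗ x⟩` are ultraweakly continuous.
The space `𝒟` is normal because normality passes to subrepresentations, to direct sums and to
interior tensor products (`isNormal_tens`). The last of these holds because the vectors whose vector
functional is continuous along a given increasing net form a closed subspace, which contains the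
elementary tensors.
-/

universe w₃

noncomputable section

namespace CorrDil

/-! ### Algebra of intertwining operators -/

section HomAlgebra

variable {M : Type u} [CStarAlgebra M]

namespace Hom

variable {R : HRep.{u, w} M} {S : HRep.{u, w₁} M} {T : HRep.{u, w₂} M} {V : HRep.{u, w₃} M}

theorem comp_assoc (f : Hom T V) (g : Hom S T) (h : Hom R S) : (f ⊚ g) ⊚ h = f ⊚ g ⊚ h := rfl

@[simp]
theorem id_comp (f : Hom R S) : Hom.id S ⊚ f = f := rfl

@[simp]
theorem comp_id (f : Hom R S) : f ⊚ Hom.id R = f := rfl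

theorem add_comp (f g : Hom S T) (h : Hom R S) : (f + g) ⊚ h = f ⊚ h + g ⊚ h := rfl

theorem comp_add (f : Hom S T) (g h : Hom R S) : f ⊚ (g + h) = f ⊚ g + f ⊚ h :=
  Hom.ext (ContinuousLinearMap.comp_add f.op g.op h.op)

@[simp]
theorem zero_comp (h : Hom R S) : (0 : Hom S T) ⊚ h = 0 := rfl

@[simp]
theorem comp_zero (f : Hom S T) : f ⊚ (0 : Hom R S) = 0 :=
  Hom.ext (ContinuousLinearMap.comp_zero f.op)

@[simp]
theorem add_zero (f : Hom R S) : f + 0 = f := Hom.ext (_root_.add_zero f.op)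

@[simp]
theorem zero_add (f : Hom R S) : 0 + f = f := Hom.ext (_root_.zero_add f.op)

theorem add_comm (f g : Hom R S) : f + g = g + f := Hom.ext (_root_.add_comm f.op g.op)

theorem add_assoc (f g h : Hom R S) : f + g + h = f + (g + h) :=
  Hom.ext (_root_.add_assoc f.op g.op h.op)

theorem adj_comp (f : Hom S T) (g : Hom R S) : (f ⊚ g)† = g† ⊚ f† :=
  Hom.ext (ContinuousLinearMap.adjoint_comp f.op g.op)

@[simp]
theorem adj_adj (f : Hom R S) : f†† = f := Hom.ext (ContinuousLinearMap.adjoint_adjoint f.op)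

theorem adj_add (f g : Hom R S) : (f + g)† = f† + g† :=
  Hom.ext (map_add ContinuousLinearMap.adjoint f.op g.op)

theorem eq_adj_of_inner {f : Hom R S} {g : Hom S R}
    (h : ∀ x y, inner ℂ (g.op x) y = inner ℂ x (f.op y)) : f† = g :=
  Hom.ext ((ContinuousLinearMap.eq_adjoint_iff g.op f.op).mpr h).symm

variable (R S)

@[simp]
theorem fst_comp_inl : fst R S ⊚ inl R S = Hom.id R := rfl

@[simp]
theorem fst_comp_inr : fst R S ⊚ inr R S = 0 := rfl

@[simp]
theorem snd_comp_inl : snd R S ⊚ inl R S = 0 := rfl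

@[simp]
theorem snd_comp_inr : snd R S ⊚ inr R S = Hom.id S := rfl

@[simp]
theorem fst_comp_inl_assoc (f : Hom V R) : fst R S ⊚ inl R S ⊚ f = f := rfl

@[simp]
theorem fst_comp_inr_assoc (f : Hom V S) : fst R S ⊚ inr R S ⊚ f = 0 := rfl

@[simp]
theorem snd_comp_inl_assoc (f : Hom V R) : snd R S ⊚ inl R S ⊚ f = 0 := rfl

@[simp]
theorem snd_comp_inr_assoc (f : Hom V S) : snd R S ⊚ inr R S ⊚ f = f := rfl

theorem inl_fst_add_inr_snd : inl R S ⊚ fst R S + inr R S ⊚ snd R S = Hom.id (R.sum S) := by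
  refine Hom.ext (ContinuousLinearMap.ext fun x => ?_)
  exact congrArg (WithLp.toLp 2) (Prod.ext (_root_.add_zero x.fst) (_root_.zero_add x.snd))

@[simp]
theorem inl_adj : (inl R S)† = fst R S := by
  refine eq_adj_of_inner fun x y => ?_
  refine Eq.trans ?_ (WithLp.prod_inner_apply (𝕜 := ℂ) x ((inl R S).op y)).symm
  have h : inner ℂ x.snd (0 : S.space) = 0 := inner_zero_right _
  exact (_root_.add_zero _).symm.trans (congrArg (inner ℂ x.fst y + ·) h.symm)

@[simp]
theorem inr_adj : (inr R S)† = snd R S := by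
  refine eq_adj_of_inner fun x y => ?_
  refine Eq.trans ?_ (WithLp.prod_inner_apply (𝕜 := ℂ) x ((inr R S).op y)).symm
  have h : inner ℂ x.fst (0 : R.space) = 0 := inner_zero_right _
  exact (_root_.zero_add _).symm.trans (congrArg (· + inner ℂ x.snd y) h.symm)

@[simp]
theorem fst_adj : (fst R S)† = inl R S := by rw [← inl_adj, adj_adj]

@[simp]
theorem snd_adj : (snd R S)† = inr R S := by rw [← inr_adj, adj_adj]

variable {R S}

section Block

variable {R' : HRep.{u, w₂} M} {S' : HRep.{u, v} M} (a : Hom R R') (b : Hom S R')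
  (c : Hom R S') (d : Hom S S')

theorem block_fst_inl : fst R' S' ⊚ block a b c d ⊚ inl R S = a := by
  simp only [block, comp_add, add_comp, comp_assoc, fst_comp_inl_assoc, fst_comp_inl,
    fst_comp_inr_assoc, snd_comp_inl, comp_id, comp_zero, add_zero]

theorem block_fst_inr : fst R' S' ⊚ block a b c d ⊚ inr R S = b := by
  simp only [block, comp_add, add_comp, comp_assoc, fst_comp_inl_assoc, fst_comp_inr,
    fst_comp_inr_assoc, snd_comp_inr, comp_id, comp_zero, add_zero, zero_add]

theorem block_snd_inl : snd R' S' ⊚ block a b c d ⊚ inl R S = c := by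
  simp only [block, comp_add, add_comp, comp_assoc, snd_comp_inl_assoc, fst_comp_inl,
    snd_comp_inr_assoc, snd_comp_inl, comp_id, comp_zero, add_zero, zero_add]

end Block

end Hom

end HomAlgebra

section TensorFunctor

variable {M : Type u} [CStarAlgebra M] [PartialOrder M] [StarOrderedRing M]
variable {R : HRep.{u, w} M} {S : HRep.{u, w₁} M} {T : HRep.{u, w₂} M}
variable (E : WStarCorr.{u, v} M)

theorem inner_sum_tmul (R : HRep.{u, w} M) {k l : ℕ} (ξ : Fin k → E.carrier)
    (x : Fin k → R.space) (η : Fin l → E.carrier) (y : Fin l → R.space) :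
    inner ℂ (∑ i, tmul E R (ξ i) (x i)) (∑ j, tmul E R (η j) (y j)) =
      ∑ i, ∑ j, inner ℂ (x i) (R.rep (E.ip (ξ i) (η j)) (y j)) := by
  simp only [sum_inner, inner_sum, inner_tmul]
  exact Finset.sum_comm

theorem norm_tmul_le (R : HRep.{u, w} M) (ξ : E.carrier) (x : R.space) :
    ‖tmul E R ξ x‖ ≤ ‖ξ‖ * ‖x‖ := by
  refine (sq_le_sq₀ (norm_nonneg _) (by positivity)).mp ?_
  have h1 : ‖R.rep (E.ip ξ ξ) x‖ ≤ ‖ξ‖ ^ 2 * ‖x‖ := by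
    rw [E.norm_sq]
    exact (R.rep (E.ip ξ ξ)).le_of_opNorm_le (NonUnitalStarAlgHom.norm_apply_le R.rep _) x
  rw [@norm_sq_eq_re_inner ℂ, inner_tmul]
  calc _ ≤ ‖x‖ * ‖R.rep (E.ip ξ ξ) x‖ := re_inner_le_norm _ _
    _ ≤ ‖x‖ * (‖ξ‖ ^ 2 * ‖x‖) := mul_le_mul_of_nonneg_left h1 (norm_nonneg _)
    _ = _ := by ring

/-- The operator `x ↦ ξ ⊗ x`. -/
def tmulL (R : HRep.{u, w} M) (ξ : E.carrier) : R.space →L[ℂ] TensSpace E R :=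
  (tmulₗ E R ξ).mkContinuous ‖ξ‖ (norm_tmul_le E R ξ)

theorem tens_hom_ext {f g : Hom (tens E R) T}
    (h : ∀ ξ x, f.op (tmul E R ξ x) = g.op (tmul E R ξ x)) : f = g :=
  Hom.ext (tens_ext h)

theorem tens_tens_hom_ext {F : WStarCorr.{u, v} M} {f g : Hom (tens E (tens F R)) T}
    (h : ∀ ξ η x, f.op (tmul E (tens F R) ξ (tmul F R η x)) =
      g.op (tmul E (tens F R) ξ (tmul F R η x))) : f = g :=
  tens_hom_ext E fun ξ z => DFunLike.congr_fun (tens_ext (E := F) (R := R)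
    (f := f.op ∘L tmulL E (tens F R) ξ) (g := g.op ∘L tmulL E (tens F R) ξ) (h ξ)) z

theorem tens_tens_tens_hom_ext {F G : WStarCorr.{u, v} M}
    {f g : Hom (tens E (tens F (tens G R))) T}
    (h : ∀ ξ η ζ x, f.op (tmul E (tens F (tens G R)) ξ (tmul F (tens G R) η (tmul G R ζ x))) =
      g.op (tmul E (tens F (tens G R)) ξ (tmul F (tens G R) η (tmul G R ζ x)))) : f = g :=
  tens_tens_hom_ext E fun ξ η z => DFunLike.congr_fun (tens_ext (E := G) (R := R)
    (f := f.op ∘L tmulL E (tens F (tens G R)) ξ ∘L tmulL F (tens G R) η)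
    (g := g.op ∘L tmulL E (tens F (tens G R)) ξ ∘L tmulL F (tens G R) η) (h ξ η)) z

@[simp]
theorem tmap_id : tmap E (Hom.id R) = Hom.id (tens E R) :=
  tens_hom_ext E fun ξ x => tmap_tmul E _ ξ x

theorem tmap_comp (f : Hom S T) (g : Hom R S) : tmap E (f ⊚ g) = tmap E f ⊚ tmap E g := by
  refine tens_hom_ext E fun ξ x => (tmap_tmul E _ ξ x).trans ?_
  refine Eq.trans ?_ (congrArg (tmap E f).op (tmap_tmul E g ξ x)).symm
  exact (tmap_tmul E f ξ (g.op x)).symm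

theorem tmap_add (f g : Hom R S) : tmap E (f + g) = tmap E f + tmap E g := by
  refine tens_hom_ext E fun ξ x => (tmap_tmul E _ ξ x).trans ?_
  refine (tmul_add E S ξ (f.op x) (g.op x)).trans ?_
  exact (congrArg₂ (· + ·) (tmap_tmul E f ξ x) (tmap_tmul E g ξ x)).symm

@[simp]
theorem tmap_zero : tmap E (0 : Hom R S) = 0 :=
  tens_hom_ext E fun ξ x => (tmap_tmul E _ ξ x).trans (map_zero (tmulₗ E S ξ))

theorem tmap_adj (f : Hom R S) : (tmap E f)† = tmap E f† := by
  refine Hom.eq_adj_of_inner fun x y => ?_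
  refine tens_induction E S
    (p := fun x => inner ℂ ((tmap E f†).op x) y = inner ℂ x ((tmap E f).op y))
    (isClosed_eq (by fun_prop) (by fun_prop)) (fun k ξ h => ?_) x
  refine tens_induction E R
    (p := fun y => inner ℂ ((tmap E f†).op (∑ i, tmul E S (ξ i) (h i))) y =
      inner ℂ (∑ i, tmul E S (ξ i) (h i)) ((tmap E f).op y))
    (isClosed_eq (by fun_prop) (by fun_prop)) (fun l η g => ?_) y
  refine (congrArg₂ (inner ℂ) (tmap_sum_tmul E f† ξ h) rfl).trans ?_
  refine Eq.trans ?_ (congrArg₂ (inner ℂ) rfl (tmap_sum_tmul E f η g)).symm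
  refine (inner_sum_tmul E R ξ _ η _).trans (Eq.trans ?_ (inner_sum_tmul E S ξ _ η _).symm)
  refine Finset.sum_congr rfl fun i _ => Finset.sum_congr rfl fun j _ => ?_
  rw [← f.comm]
  exact ContinuousLinearMap.adjoint_inner_left f.op _ _

end TensorFunctor

/-! ### Normal representations -/

section Normality

variable {M : Type u} [CStarAlgebra M]

namespace HRep

/-- The vectors `x` for which `⟨x, σ(s - a) x⟩` becomes arbitrarily small for `a ∈ S`; these are
the vectors whose vector functional is continuous along `S` when `s` is the supremum of `S`. -/
def normalVectors (R : HRep.{u, w} M) (S : Set M) (s : M) : Set R.space :=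
  {x | ∀ ε : ℝ, 0 < ε → ∃ a ∈ S, (inner ℂ x (R.rep (s - a) x)).re < ε}

theorem mem_normalVectors_of_isLUB {R : HRep.{u, w} M} {S : Set M} {s : M} {x : R.space}
    (h : IsLUB ((fun a : M => (inner ℂ x (R.rep a x)).re) '' S) (inner ℂ x (R.rep s x)).re) :
    x ∈ R.normalVectors S s := fun ε hε => by
  obtain ⟨_, ⟨a, ha, rfl⟩, h1, -⟩ := h.exists_between (sub_lt_self _ hε)
  refine ⟨a, ha, ?_⟩
  rw [map_sub, sub_apply, inner_sub_right, Complex.sub_re]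
  linarith

end HRep

variable [PartialOrder M]

theorem HRep.IsNormal.mem_normalVectors {R : HRep.{u, w} M} (hR : R.IsNormal) {S : Set M}
    (hne : S.Nonempty) (hd : DirectedOn (· ≤ ·) S) (hsa : ∀ a ∈ S, IsSelfAdjoint a) {s : M}
    (hs : IsLUB S s) (x : R.space) : x ∈ R.normalVectors S s :=
  HRep.mem_normalVectors_of_isLUB (hR x S hne hd hsa s hs)

theorem isNormal_rangeRep {R : HRep.{u, w} M} {S : HRep.{u, w₁} M} (D : Hom R S)
    (hS : S.IsNormal) : (rangeRep D).IsNormal :=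
  fun x => hS x.1

variable [StarOrderedRing M]

namespace HRep

theorem inner_rep_nonneg (R : HRep.{u, w} M) {a : M} (ha : 0 ≤ a) (x : R.space) :
    0 ≤ inner ℂ x (R.rep a x) := by
  obtain ⟨c, rfl⟩ := CStarAlgebra.nonneg_iff_eq_star_mul_self.mp ha
  rw [← R.rep_star_rep, inner_self_eq_norm_sq_to_K]
  exact pow_nonneg (Complex.zero_le_real.mpr (norm_nonneg (R.rep c x))) 2

theorem re_inner_rep_mono (R : HRep.{u, w} M) (x : R.space) :
    Monotone fun a : M => (inner ℂ x (R.rep a x)).re := fun a b hab => by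
  have := (Complex.le_def.mp (R.inner_rep_nonneg (sub_nonneg.mpr hab) x)).1
  rw [map_sub, sub_apply, inner_sub_right, Complex.sub_re, Complex.zero_re] at this
  exact sub_nonneg.mp this

theorem isLUB_of_mem_normalVectors {R : HRep.{u, w} M} {S : Set M} {s : M} {x : R.space}
    (hs : IsLUB S s) (h : x ∈ R.normalVectors S s) :
    IsLUB ((fun a : M => (inner ℂ x (R.rep a x)).re) '' S) (inner ℂ x (R.rep s x)).re := by
  refine ⟨?_, fun b hb => ?_⟩
  · rintro _ ⟨a, ha, rfl⟩
    exact R.re_inner_rep_mono x (hs.1 ha)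
  · refine le_of_forall_pos_le_add fun ε hε => ?_
    obtain ⟨a, ha, h1⟩ := h ε hε
    have h2 := hb ⟨a, ha, rfl⟩
    rw [map_sub, sub_apply, inner_sub_right, Complex.sub_re] at h1
    dsimp only at h2
    linarith

/-- The parallelogram inequality for the positive form `⟨x, σ(b) y⟩`. -/
theorem re_inner_rep_add_le (R : HRep.{u, w} M) {b : M} (hb : 0 ≤ b) (x y : R.space) :
    (inner ℂ (x + y) (R.rep b (x + y))).re ≤
      2 * (inner ℂ x (R.rep b x)).re + 2 * (inner ℂ y (R.rep b y)).re := by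
  have h := (Complex.le_def.mp (R.inner_rep_nonneg hb (x - y))).1
  simp only [map_add, map_sub, inner_add_left, inner_add_right, inner_sub_left, inner_sub_right,
    Complex.add_re, Complex.sub_re, Complex.zero_re] at h ⊢
  linarith

theorem add_mem_normalVectors {R : HRep.{u, w} M} {S : Set M} {s : M}
    (hd : DirectedOn (· ≤ ·) S) (hs : s ∈ upperBounds S) {x y : R.space}
    (hx : x ∈ R.normalVectors S s) (hy : y ∈ R.normalVectors S s) :
    x + y ∈ R.normalVectors S s := fun ε hε => by
  obtain ⟨a, ha, h1⟩ := hx (ε / 4) (by positivity)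
  obtain ⟨b, hb, h2⟩ := hy (ε / 4) (by positivity)
  obtain ⟨c, hc, hac, hbc⟩ := hd a ha b hb
  refine ⟨c, hc, (R.re_inner_rep_add_le (sub_nonneg.mpr (hs hc)) x y).trans_lt ?_⟩
  have h3 := R.re_inner_rep_mono x (sub_le_sub_left hac s)
  have h4 := R.re_inner_rep_mono y (sub_le_sub_left hbc s)
  dsimp only at h3 h4
  linarith

theorem isClosed_normalVectors {R : HRep.{u, w} M} {S : Set M} {s : M} (hne : S.Nonempty)
    (hd : DirectedOn (· ≤ ·) S) (hs : s ∈ upperBounds S) : IsClosed (R.normalVectors S s) := by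
  refine isClosed_of_closure_subset fun x hx ε hε => ?_
  -- the form of `s - a₀` dominates the forms of all `s - a` with `a ≥ a₀`
  obtain ⟨a₀, ha₀⟩ := hne
  set N := ‖R.rep (s - a₀)‖
  have hδ : 0 < ε / (4 * (N + 1)) := by positivity
  obtain ⟨y, hy, hxy⟩ := Metric.mem_closure_iff.mp hx (min 1 (ε / (4 * (N + 1)))) (by positivity)
  rw [dist_eq_norm] at hxy
  obtain ⟨b, hb, h1⟩ := hy (ε / 4) (by positivity)
  obtain ⟨c, hc, hac, hbc⟩ := hd a₀ ha₀ b hb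
  refine ⟨c, hc, ?_⟩
  have h2 := R.re_inner_rep_add_le (sub_nonneg.mpr (hs hc)) (x - y) y
  rw [sub_add_cancel] at h2
  have h3 := R.re_inner_rep_mono (x - y) (sub_le_sub_left hac s)
  have h4 := R.re_inner_rep_mono y (sub_le_sub_left hbc s)
  have h5 : (inner ℂ (x - y) (R.rep (s - a₀) (x - y))).re ≤ ‖x - y‖ * (N * ‖x - y‖) :=
    (re_inner_le_norm (𝕜 := ℂ) _ _).trans
      (mul_le_mul_of_nonneg_left ((R.rep (s - a₀)).le_opNorm _) (norm_nonneg _))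
  have h6 : ‖x - y‖ * (N * ‖x - y‖) ≤ 1 * ((N + 1) * (ε / (4 * (N + 1)))) := by
    have hN : 0 ≤ N := norm_nonneg _
    have := hxy.le.trans (min_le_left _ _)
    have := hxy.le.trans (min_le_right _ _)
    gcongr
    linarith
  have h7 : 1 * ((N + 1) * (ε / (4 * (N + 1)))) = ε / 4 := by
    have : 0 < N + 1 := by positivity
    field_simp
  dsimp only at h3 h4
  linarith

theorem isNormal_of_forall {R : HRep.{u, w} M}
    (h : ∀ S : Set M, S.Nonempty → DirectedOn (· ≤ ·) S → (∀ a ∈ S, IsSelfAdjoint a) →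
      ∀ s : M, IsLUB S s → ∀ x, x ∈ R.normalVectors S s) : R.IsNormal :=
  fun x S hne hd hsa s hs => isLUB_of_mem_normalVectors hs (h S hne hd hsa s hs x)

theorem IsNormal.sum {R : HRep.{u, w} M} {S : HRep.{u, w₁} M} (hR : R.IsNormal)
    (hS : S.IsNormal) : (R.sum S).IsNormal := by
  refine isNormal_of_forall fun A hne hd hsa s hs x => ?_
  have hx : x = (Hom.inl R S).op x.fst + (Hom.inr R S).op x.snd :=
    (DFunLike.congr_fun (congrArg Hom.op (Hom.inl_fst_add_inr_snd R S)) x).symm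
  rw [hx]
  have isom₁ : ∀ (a : M) (y : R.space), inner ℂ ((Hom.inl R S).op y)
      ((R.sum S).rep a ((Hom.inl R S).op y)) = inner ℂ y (R.rep a y) := fun a y => by
    refine (WithLp.prod_inner_apply (𝕜 := ℂ) ((Hom.inl R S).op y) _).trans ?_
    have : inner ℂ (0 : S.space) (S.rep a 0) = 0 := inner_zero_left _
    exact (congrArg (inner ℂ y (R.rep a y) + ·) this).trans (add_zero _)
  have isom₂ : ∀ (a : M) (y : S.space), inner ℂ ((Hom.inr R S).op y)
      ((R.sum S).rep a ((Hom.inr R S).op y)) = inner ℂ y (S.rep a y) := fun a y => by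
    refine (WithLp.prod_inner_apply (𝕜 := ℂ) ((Hom.inr R S).op y) _).trans ?_
    have : inner ℂ (0 : R.space) (R.rep a 0) = 0 := inner_zero_left _
    exact (congrArg (· + inner ℂ y (S.rep a y)) this).trans (zero_add _)
  refine add_mem_normalVectors hd hs.1 (fun ε hε => ?_) (fun ε hε => ?_)
  · obtain ⟨a, ha, h⟩ := hR.mem_normalVectors hne hd hsa hs x.fst ε hε
    exact ⟨a, ha, by rwa [isom₁]⟩
  · obtain ⟨a, ha, h⟩ := hS.mem_normalVectors hne hd hsa hs x.snd ε hε
    exact ⟨a, ha, by rwa [isom₂]⟩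

end HRep

theorem WStarCorr.ip_smul_mono (E : WStarCorr.{u, v} M) (ξ : E.carrier) :
    Monotone fun a : M => E.ip ξ (a • ξ) := fun a b hab => by
  obtain ⟨c, hc⟩ := CStarAlgebra.nonneg_iff_eq_star_mul_self.mp (sub_nonneg.mpr hab)
  have h := E.ip_self_nonneg (c • ξ)
  rw [E.left_adjoint, smul_smul, ← hc, sub_smul] at h
  have h' : E.ip ξ (b • ξ - a • ξ) = E.ip ξ (b • ξ) - E.ip ξ (a • ξ) := map_sub (E.ipₛₗ ξ) _ _
  rw [h'] at h
  exact sub_nonneg.mp h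

/-- The interior tensor product of a W*-correspondence with a normal representation is normal. -/
theorem isNormal_tens (E : WStarCorr.{u, v} M) {R : HRep.{u, w} M} (hR : R.IsNormal) :
    (tens E R).IsNormal := by
  refine HRep.isNormal_of_forall fun S hne hd hsa s hs z => ?_
  refine tens_induction E R (p := fun z => z ∈ (tens E R).normalVectors S s)
    (HRep.isClosed_normalVectors (R := tens E R) hne hd hs.1) (fun k ξ h => ?_) z
  have h0 : (0 : (tens E R).space) ∈ (tens E R).normalVectors S s := fun ε hε =>
    ⟨hne.some, hne.some_mem, by rw [inner_zero_left]; exact hε⟩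
  refine Finset.sum_induction _ (fun z => z ∈ (tens E R).normalVectors S s)
    (fun x y hx hy => HRep.add_mem_normalVectors (R := tens E R) hd hs.1 hx hy) h0
    fun i _ ε hε => ?_
  have hd' : DirectedOn (· ≤ ·) ((fun a : M => E.ip (ξ i) (a • ξ i)) '' S) :=
    hd.mono_comp fun {_ _} h => E.ip_smul_mono (ξ i) h
  obtain ⟨_, ⟨a, ha, rfl⟩, h1⟩ := hR.mem_normalVectors (hne.image _) hd' (by
      rintro _ ⟨a, ha, rfl⟩
      rw [IsSelfAdjoint, E.star_ip, E.left_adjoint, hsa a ha])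
    (E.left_normal (ξ i) S hne hd hsa s hs) (h i) ε hε
  refine ⟨a, ha, lt_of_eq_of_lt (congrArg Complex.re ?_) h1⟩
  refine (congrArg (inner ℂ (tmul E R (ξ i) (h i))) (leftAct_tmul E R (s - a) (ξ i) (h i))).trans ?_
  rw [inner_tmul, sub_smul]
  congr 3
  exact map_sub (E.ipₛₗ (ξ i)) _ _

end Normality

/-! ### The multiplication maps of a product system -/

section Multiplication

variable {M : Type u} [CStarAlgebra M] [PartialOrder M] [StarOrderedRing M]

/-- The positive functional `a ↦ ⟨x, σ(a) x⟩`. -/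
def HRep.vectorFunctional (R : HRep.{u, w} M) (x : R.space) : M →L[ℂ] ℂ :=
  LinearMap.mkContinuous
    { toFun := fun a => inner ℂ x (R.rep a x)
      map_add' := fun a b => by simp
      map_smul' := fun c a => by simp } (‖x‖ * ‖x‖) fun a => by
    refine (norm_inner_le_norm _ _).trans ?_
    have := (R.rep a).le_of_opNorm_le (NonUnitalStarAlgHom.norm_apply_le R.rep a) x
    calc ‖x‖ * ‖R.rep a x‖ ≤ ‖x‖ * (‖a‖ * ‖x‖) := mul_le_mul_of_nonneg_left this (norm_nonneg _)
      _ = _ := by ring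

theorem HRep.IsNormal.isNormalFunctional {R : HRep.{u, w} M} (hR : R.IsNormal) (x : R.space) :
    IsNormalFunctional (R.vectorFunctional x) :=
  ⟨fun _ ha => R.inner_rep_nonneg ha x, hR x⟩

/-- The functionals `ζ ↦ ⟨y, ζ ⊗ x⟩` belong to the predual of `E` if the representation is
normal. -/
theorem isUltraweak_inner_tmul (E : WStarCorr.{u, v} M) {R : HRep.{u, w} M} (hR : R.IsNormal)
    (y : TensSpace E R) (x : R.space) :
    E.IsUltraweak ((innerSL ℂ y).toLinearMap ∘ₗ (tmulₗ E R).flip x) := by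
  intro ε hε
  obtain ⟨z, hz, k, ξ, h, rfl⟩ : ∃ z : TensSpace E R, ‖y - z‖ * ‖x‖ ≤ ε ∧
      ∃ (k : ℕ) (ξ : Fin k → E.carrier) (h : Fin k → R.space),
        z = ∑ i, tmul E R (ξ i) (h i) := by
    have hδ : 0 < ε / (‖x‖ + 1) := by positivity
    obtain ⟨t, ht⟩ := (denseRange_toTens E R).exists_dist_lt y hδ
    refine ⟨toTens E R t, ?_, ?_⟩
    · rw [dist_eq_norm, lt_div_iff₀ (by positivity)] at ht
      nlinarith [norm_nonneg (y - toTens E R t)]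
    · obtain ⟨k, ξ, h, rfl⟩ := TensorProduct.exists_sum_tmul_eq t
      exact ⟨k, ξ, h, by simp [tmul]⟩
  -- polarization: `4 ⟨h, σ(a) x⟩ = ∑ c̄ ⟨h + c x, σ(a) (h + c x)⟩` over the fourth roots of unity `c`
  let c : Fin 4 → ℂ := ![1, -1, Complex.I, -Complex.I]
  have hpol : ∀ (g : R.space) (a : M), inner ℂ g (R.rep a x) =
      ∑ j, (starRingEnd ℂ (c j) / 4) * inner ℂ (g + c j • x) (R.rep a (g + c j • x)) := by
    intro g a
    simp only [c, Fin.sum_univ_four, Matrix.cons_val_zero, Matrix.cons_val_one, Matrix.cons_val,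
      map_add, map_smul, inner_add_left, inner_add_right, inner_smul_left, inner_smul_right,
      map_one, map_neg, Complex.conj_I]
    ring_nf
    simp only [Complex.I_sq]
    ring
  let e : Fin (k * 4) ≃ Fin k × Fin 4 := finProdFinEquiv.symm
  refine ⟨k * 4, fun i => (c (e i).2 / 4) • ξ (e i).1,
    fun i => R.vectorFunctional (h (e i).1 + c (e i).2 • x),
    fun i => hR.isNormalFunctional _, fun η => ?_⟩
  have hsum : ∑ i, R.vectorFunctional (h (e i).1 + c (e i).2 • x)
      (E.ip ((c (e i).2 / 4) • ξ (e i).1) η) =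
      inner ℂ (∑ i, tmul E R (ξ i) (h i)) (tmul E R η x) := by
    rw [Equiv.sum_comp e (fun p => R.vectorFunctional (h p.1 + c p.2 • x)
      (E.ip ((c p.2 / 4) • ξ p.1) η)), Fintype.sum_prod_type, sum_inner]
    refine Finset.sum_congr rfl fun i _ => ?_
    rw [inner_tmul, hpol]
    refine Finset.sum_congr rfl fun j _ => ?_
    rw [E.ip_smul_left, map_smul, smul_eq_mul, star_div₀]
    simp [HRep.vectorFunctional]
  rw [hsum]
  refine (congrArg norm (inner_sub_left y _ (tmul E R η x)).symm).trans_le ?_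
  refine (norm_inner_le_norm _ _).trans ?_
  calc _ ≤ ‖y - ∑ i, tmul E R (ξ i) (h i)‖ * (‖η‖ * ‖x‖) :=
        mul_le_mul_of_nonneg_left (norm_tmul_le E R η x) (norm_nonneg _)
    _ = (‖y - ∑ i, tmul E R (ξ i) (h i)‖ * ‖x‖) * ‖η‖ := by ring
    _ ≤ ε * ‖η‖ := mul_le_mul_of_nonneg_right hz (norm_nonneg _)

namespace ProductSystem

variable {n : ℕ} (P : ProductSystem.{u, v} M n) (R : HRep.{u, w} M)
variable {s t r : Fin n → ℕ} (h : s + t = r)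

theorem mulMap_tmul_space (ξ : (P.X s).carrier) (z : (tens (P.X t) R).space) :
    (P.mulMap R h).op (tmul (P.X s) (tens (P.X t) R) ξ z) = P.mulOp R h ξ z :=
  tensLift_tmul (P.mulBilin_bound R h) ξ z

/-- The identification `X s ⊗ (X t ⊗ H) → X (s + t) ⊗ H` is isometric. -/
@[simp]
theorem mulMap_adj_comp : (P.mulMap R h)† ⊚ P.mulMap R h = Hom.id _ := by
  refine tens_hom_ext _ fun ξ z => ext_inner_right ℂ fun y => ?_
  refine (ContinuousLinearMap.adjoint_inner_left (P.mulMap R h).op _ _).trans ?_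
  refine tens_induction (P.X s) (tens (P.X t) R) (p := fun y => inner ℂ
    ((P.mulMap R h).op (tmul (P.X s) (tens (P.X t) R) ξ z)) ((P.mulMap R h).op y) =
    inner ℂ (tmul (P.X s) (tens (P.X t) R) ξ z) y)
    (isClosed_eq (by fun_prop) (by fun_prop)) (fun k η x => ?_) y
  refine (congrArg₂ (inner ℂ) rfl (map_sum (P.mulMap R h).op _ _)).trans ?_
  rw [inner_sum, inner_sum]
  refine Finset.sum_congr rfl fun i _ => ?_
  refine (congrArg₂ (inner ℂ) (P.mulMap_tmul_space R h ξ z)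
    (P.mulMap_tmul_space R h (η i) (x i))).trans ?_
  refine (P.inner_mulOp R h _ _ _ _).trans ?_
  exact (inner_tmul (P.X s) (tens (P.X t) R) _ _ _ _).symm

variable {R} in
/-- On a normal representation the identification `X s ⊗ (X t ⊗ H) → X (s + t) ⊗ H` is onto. -/
theorem mulMap_comp_adj (hR : R.IsNormal) : P.mulMap R h ⊚ (P.mulMap R h)† = Hom.id _ := by
  -- a vector orthogonal to the range is annihilated by all functionals `ζ ↦ ⟨y, ζ ⊗ x⟩`
  have key : ∀ y, (P.mulMap R h)†.op y = 0 → y = 0 := fun y hy => by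
    have h1 : ∀ x, (innerSL ℂ y).toLinearMap ∘ₗ (tmulₗ (P.X r) R).flip x = 0 := fun x => by
      refine P.dense_mul h _ (isUltraweak_inner_tmul (P.X r) hR y x) fun ξ η => ?_
      refine (congrArg (inner ℂ y) (P.mulMap_tmul R h ξ η x).symm).trans ?_
      refine (ContinuousLinearMap.adjoint_inner_left (P.mulMap R h).op _ y).symm.trans ?_
      exact (congrArg₂ (inner ℂ) hy rfl).trans (inner_zero_left _)
    have h2 : ∀ z, inner ℂ y z = 0 := fun z => by
      refine tens_induction (P.X r) R (p := fun z => inner ℂ y z = 0)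
        (isClosed_eq (by fun_prop) (by fun_prop)) (fun k ζ x => ?_) z
      refine (inner_sum (𝕜 := ℂ) _ _ _).trans (Finset.sum_eq_zero fun i _ => ?_)
      exact LinearMap.congr_fun (h1 (x i)) (ζ i)
    exact inner_self_eq_zero.mp (h2 y)
  refine Hom.ext (ContinuousLinearMap.ext fun y => ?_)
  refine (sub_eq_zero.mp (key _ ?_)).symm
  refine (map_sub (P.mulMap R h)†.op y _).trans (sub_eq_zero.mpr ?_)
  exact (DFunLike.congr_fun (congrArg Hom.op (P.mulMap_adj_comp R h)) ((P.mulMap R h)†.op y)).symm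

variable {R}

theorem mulMap_natural {S : HRep.{u, w₁} M} (f : Hom R S) :
    P.mulMap S h ⊚ tmap (P.X s) (tmap (P.X t) f) = tmap (P.X r) f ⊚ P.mulMap R h := by
  refine tens_tens_hom_ext _ fun ξ η x => ?_
  refine (congrArg (P.mulMap S h).op ((tmap_tmul (P.X s) (tmap (P.X t) f) ξ _).trans
    (congrArg (tmul (P.X s) (tens (P.X t) S) ξ) (tmap_tmul (P.X t) f η x)))).trans ?_
  refine (P.mulMap_tmul S h ξ η (f.op x)).trans ?_
  exact ((congrArg (tmap (P.X r) f).op (P.mulMap_tmul R h ξ η x)).trans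
    (tmap_tmul (P.X r) f _ x)).symm

theorem mulMap_adj_natural {S : HRep.{u, w₁} M} (f : Hom R S) :
    (P.mulMap S h)† ⊚ tmap (P.X r) f = tmap (P.X s) (tmap (P.X t) f) ⊚ (P.mulMap R h)† := by
  have := congrArg Hom.adj (P.mulMap_natural h f†)
  rw [Hom.adj_comp, Hom.adj_comp, tmap_adj, tmap_adj, tmap_adj, Hom.adj_adj] at this
  exact this.symm

theorem flip_natural {S : HRep.{u, w₁} M} (f : Hom R S) :
    P.flip S ⊚ tmap (P.X s) (tmap (P.X t) f) = tmap (P.X t) (tmap (P.X s) f) ⊚ P.flip R := by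
  rw [flip, Hom.comp_assoc, mulMap_natural, ← Hom.comp_assoc, mulMap_adj_natural]
  rfl

variable (R)

theorem mulMap_assoc {q st tq stq : Fin n → ℕ} (h₁ : s + t = st) (h₂ : st + q = stq)
    (h₃ : t + q = tq) (h₄ : s + tq = stq) :
    P.mulMap R h₂ ⊚ P.mulMap (tens (P.X q) R) h₁ =
      P.mulMap R h₄ ⊚ tmap (P.X s) (P.mulMap R h₃) := by
  refine tens_tens_tens_hom_ext _ fun ξ η ζ x => ?_
  refine (congrArg (P.mulMap R h₂).op (P.mulMap_tmul (tens (P.X q) R) h₁ ξ η _)).trans ?_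
  refine (P.mulMap_tmul R h₂ _ ζ x).trans ?_
  refine Eq.trans ?_ (congrArg (P.mulMap R h₄).op ((tmap_tmul (P.X s) (P.mulMap R h₃) ξ _).trans
    (congrArg (tmul (P.X s) (tens (P.X tq) R) ξ) (P.mulMap_tmul R h₃ η ζ x)))).symm
  refine Eq.trans ?_ (P.mulMap_tmul R h₄ ξ _ x).symm
  rw [P.mul_assoc h₁ h₂ h₃ h₄]

end ProductSystem

end Multiplication

/-! ### Direct sums and flips -/

section LpSums

variable {M : Type u} [CStarAlgebra M] {ι : Type} {F : ι → HRep.{u, w} M}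

theorem lpSum_hom_ext {R : HRep.{u, w₁} M} {f g : Hom R (lpSum F)}
    (h : ∀ i, lpProj F i ⊚ f = lpProj F i ⊚ g) : f = g :=
  Hom.ext <| ContinuousLinearMap.ext fun x => Subtype.ext <| funext fun i =>
    DFunLike.congr_fun (congrArg Hom.op (h i)) x

theorem lpProj_adj_apply [DecidableEq ι] (i : ι) (x : (F i).space) :
    (lpProj F i)†.op x = lp.single 2 i x := by
  refine ext_inner_right ℂ fun y => ?_
  refine (ContinuousLinearMap.adjoint_inner_left (lpProj F i).op _ _).trans ?_
  exact (lp.inner_single_left (𝕜 := ℂ) (G := fun i => (F i).space) i x y).symm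

theorem lpProj_comp_adj (i : ι) : lpProj F i ⊚ (lpProj F i)† = Hom.id (F i) := by
  classical
  refine Hom.ext (ContinuousLinearMap.ext fun x => ?_)
  refine (congrArg (lpProj F i).op (lpProj_adj_apply i x)).trans ?_
  exact lp.single_apply_self (E := fun i => (F i).space) 2 i x

theorem lpProj_comp_adj_of_ne {i j : ι} (hij : j ≠ i) : lpProj F j ⊚ (lpProj F i)† = 0 := by
  classical
  refine Hom.ext (ContinuousLinearMap.ext fun x => ?_)
  refine (congrArg (lpProj F j).op (lpProj_adj_apply i x)).trans ?_
  exact lp.single_apply_ne (E := fun i => (F i).space) 2 i x hij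

/-- An operator on an `ℓ²`-direct sum is determined by its restrictions to the summands. -/
theorem lpSum_clm_ext {K : Type*} [NormedAddCommGroup K] [NormedSpace ℂ K]
    {f g : (lpSum F).space →L[ℂ] K}
    (h : ∀ i x, f ((lpProj F i)†.op x) = g ((lpProj F i)†.op x)) : f = g := by
  classical
  refine lp.ext_continuousLinearMap (by norm_num) fun i => ContinuousLinearMap.ext fun x => ?_
  have h1 := h i x
  rw [lpProj_adj_apply] at h1
  exact h1

theorem pull_comp_adj {G : ι → HRep.{u, w₁} M} (f : ∀ i, Hom (F i) (G i)) (C : ℝ) (hC : 0 ≤ C)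
    (h : ∀ i, ‖(f i).op‖ ≤ C) (i : ι) :
    Hom.pull (F := F) id Function.injective_id f C hC h ⊚ (lpProj F i)† =
      (lpProj G i)† ⊚ f i := by
  refine lpSum_hom_ext fun j => ?_
  change f j ⊚ (lpProj F j ⊚ (lpProj F i)†) = (lpProj G j ⊚ (lpProj G i)†) ⊚ f i
  by_cases hij : j = i
  · subst hij
    rw [lpProj_comp_adj, lpProj_comp_adj]; rfl
  · rw [lpProj_comp_adj_of_ne hij, lpProj_comp_adj_of_ne hij, Hom.comp_zero]; rfl

variable [PartialOrder M] [StarOrderedRing M] (E : WStarCorr.{u, v} M)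

theorem dist_comp_tmap_adj (i : ι) :
    CorrDil.dist E F ⊚ tmap E (lpProj F i)† = (lpProj (fun i => tens E (F i)) i)† := by
  refine lpSum_hom_ext fun j => ?_
  change tmap E (lpProj F j) ⊚ tmap E (lpProj F i)† = _
  rw [← tmap_comp]
  by_cases hij : j = i
  · subst hij
    rw [lpProj_comp_adj, lpProj_comp_adj, tmap_id]
  · rw [lpProj_comp_adj_of_ne hij, lpProj_comp_adj_of_ne hij, tmap_zero]

theorem shift_comp_dist_comp_tmap_adj {κ : Type} (φ : ι → κ) (hφ : Function.Injective φ)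
    {G : κ → HRep.{u, max v w} M} (f : ∀ i, Hom (tens E (F i)) (G (φ i))) (C : ℝ) (hC : 0 ≤ C)
    (h : ∀ i, ‖(f i).op‖ ≤ C) (i : ι) :
    (Hom.shift φ hφ f C hC h ⊚ CorrDil.dist E F) ⊚ tmap E (lpProj F i)† =
      (lpProj G (φ i))† ⊚ f i := by
  rw [Hom.comp_assoc, dist_comp_tmap_adj, Hom.shift_incl]

theorem tens_tens_lpSum_hom_ext (E' : WStarCorr.{u, v} M) {T : HRep.{u, w₂} M}
    {f g : Hom (tens E (tens E' (lpSum F))) T}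
    (h : ∀ i, f ⊚ tmap E (tmap E' (lpProj F i)†) = g ⊚ tmap E (tmap E' (lpProj F i)†)) :
    f = g := by
  refine tens_tens_hom_ext E fun ξ η z => DFunLike.congr_fun (lpSum_clm_ext (F := F)
    (f := f.op ∘L tmulL E (tens E' (lpSum F)) ξ ∘L tmulL E' (lpSum F) η)
    (g := g.op ∘L tmulL E (tens E' (lpSum F)) ξ ∘L tmulL E' (lpSum F) η) fun i x => ?_) z
  have h1 : (tmap E (tmap E' (lpProj F i)†)).op
      (tmul E (tens E' (F i)) ξ (tmul E' (F i) η x)) =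
      tmul E (tens E' (lpSum F)) ξ (tmul E' (lpSum F) η ((lpProj F i)†.op x)) :=
    (tmap_tmul E (tmap E' (lpProj F i)†) ξ _).trans
      (congrArg (tmul E (tens E' (lpSum F)) ξ) (tmap_tmul E' (lpProj F i)† η x))
  refine (congrArg f.op h1).symm.trans (Eq.trans ?_ (congrArg g.op h1))
  exact DFunLike.congr_fun (congrArg Hom.op (h i)) _

end LpSums

section Flip

variable {M : Type u} [CStarAlgebra M] [PartialOrder M] [StarOrderedRing M]

namespace ProductSystem

variable {n : ℕ} (P : ProductSystem.{u, v} M n) {R : HRep.{u, w} M}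
variable {s t c : Fin n → ℕ}

theorem mulMap_comp_flip {r : Fin n → ℕ} (hR : R.IsNormal) (h : s + t = r) (h' : t + s = r) :
    P.mulMap R h' ⊚ P.flip R = P.mulMap R h := by
  subst h
  rw [flip, ← Hom.comp_assoc, P.mulMap_comp_adj _ hR, Hom.id_comp]

/-- Moving `X s` past `X α ⊗ X c = X β` in one step or in two steps gives the same result. -/
theorem flip_comp_tmap_mulMap (hR : R.IsNormal) {α β : Fin n → ℕ} (h : α + c = β) :
    P.flip R (s := s) (t := β) ⊚ tmap (P.X s) (P.mulMap R h) =
      P.mulMap (tens (P.X s) R) h ⊚ tmap (P.X α) (P.flip R) ⊚ P.flip (tens (P.X c) R) := by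
  have key : P.mulMap R (add_comm β s) ⊚
      (P.mulMap (tens (P.X s) R) h ⊚ tmap (P.X α) (P.flip R (s := s) (t := c)) ⊚
        P.flip (tens (P.X c) R)) = P.mulMap R rfl ⊚ tmap (P.X s) (P.mulMap R h) := by
    have h₁ : α + (s + c) = s + β := by rw [← h]; exact add_left_comm α s c
    have h₂ : s + α + c = s + β := by rw [add_assoc, h]
    rw [← Hom.comp_assoc, P.mulMap_assoc R h (add_comm β s) (add_comm c s) h₁, Hom.comp_assoc,
      ← Hom.comp_assoc (tmap _ _), ← tmap_comp, P.mulMap_comp_flip hR rfl (add_comm c s),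
      ← Hom.comp_assoc, ← P.mulMap_assoc R (add_comm α s) h₂ rfl h₁, Hom.comp_assoc,
      P.mulMap_comp_flip (isNormal_tens _ hR) rfl (add_comm α s), P.mulMap_assoc R rfl h₂ h rfl]
  rw [flip, Hom.comp_assoc, ← key, ← Hom.comp_assoc, mulMap_adj_comp, Hom.id_comp]

/-- Moving `X s` and `X t` past `X α` and multiplying them is the same as multiplying them and
moving the product past `X α`. -/
theorem mulMap_comp_tmap_mulMap_comp_flip_comp_flip (hR : R.IsNormal) {α β : Fin n → ℕ} (h : s + t = c)
    (h₁ : α + c = β) (h₂ : c + α = β) :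
    P.mulMap R h₁ ⊚ tmap (P.X α) (P.mulMap R h) ⊚ P.flip (tens (P.X t) R) ⊚
        tmap (P.X s) (P.flip R) = P.mulMap R h₂ ⊚ P.mulMap (tens (P.X α) R) h := by
  have h₃ : s + α + t = β := by rw [← h₂, ← h, add_right_comm]
  have h₄ : s + (α + t) = β := by rw [← h₃, add_assoc]
  have h₅ : s + (t + α) = β := by rw [← h₂, ← h, add_assoc]
  rw [← Hom.comp_assoc, ← P.mulMap_assoc R (add_comm α s) h₃ h h₁, Hom.comp_assoc,
    ← Hom.comp_assoc (P.mulMap (tens (P.X t) R) _),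
    P.mulMap_comp_flip (isNormal_tens _ hR) rfl (add_comm α s), ← Hom.comp_assoc,
    P.mulMap_assoc R rfl h₃ (add_comm α t) h₅, Hom.comp_assoc, ← tmap_comp,
    P.mulMap_comp_flip hR rfl (add_comm α t), ← P.mulMap_assoc R h h₂ rfl h₅]

end ProductSystem
end Flip

/-! ### Operators on the Fock space -/

section FockSpace

variable {M : Type u} [CStarAlgebra M] [PartialOrder M] [StarOrderedRing M]

namespace ProductSystem

variable {m : ℕ} (P : ProductSystem.{u, v} M (m + 2)) {R : HRep.{u, v} M}

theorem expo_add_single (α : Fin (m + 1) → ℕ) : expo α + e₁ₙ m = expo (α + Pi.single 0 1) := by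
  rw [expo_add, expo_single]

variable (R) in
/-- The inclusion of the summand `E^α ⊗ H` into `F(E) ⊗ H`. -/
def fockIncl (α : Fin (m + 1) → ℕ) : Hom (tens (P.X (expo α)) R) (P.fock R) :=
  (lpProj (fun α : Fin (m + 1) → ℕ => tens (P.X (expo α)) R) α)†

variable (R) in
/-- The identification of `X s ⊗ F(E) ⊗ H` with `F(E) ⊗ X s ⊗ H` given by the product system, for
an arbitrary exponent `s`. -/
def fockFlipX (s : Fin (m + 2) → ℕ) : Hom (tens (P.X s) (P.fock R)) (P.fock (tens (P.X s) R)) :=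
  Hom.pull (F := fun α : Fin (m + 1) → ℕ => tens (P.X s) (tens (P.X (expo α)) R)) id
    Function.injective_id (fun α => P.flip R (s := s) (t := expo α)) 1 zero_le_one
    (fun _ => P.norm_flip_le R) ⊚ CorrDil.dist (P.X s) fun α => tens (P.X (expo α)) R

theorem fockFlipX_comp_tmap_fockIncl (s : Fin (m + 2) → ℕ) (α : Fin (m + 1) → ℕ) :
    P.fockFlipX R s ⊚ tmap (P.X s) (P.fockIncl R α) = P.fockIncl (tens (P.X s) R) α ⊚ P.flip R :=
  (congrArg (Hom.comp _)
    (dist_comp_tmap_adj (F := fun α => tens (P.X (expo α)) R) (P.X s) α)).trans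
    (pull_comp_adj _ 1 zero_le_one (fun _ => P.norm_flip_le R) α)

/-- For `a : X s ⊗ H → H` and `b : X s ⊗ H → E_{1n} ⊗ H`, the operator `I_{F(E)} ⊗ (a + b)` from
`X s ⊗ F(E) ⊗ H = F(E) ⊗ X s ⊗ H` to `F(E) ⊗ H`, where `F(E) ⊗ E_{1n} ⊗ H` is embedded in
`F(E) ⊗ H`. -/
def fockExt (s : Fin (m + 2) → ℕ) (a : Hom (tens (P.X s) R) R)
    (b : Hom (tens (P.X s) R) (tens P.E₁ₙ R)) : Hom (tens (P.X s) (P.fock R)) (P.fock R) :=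
  (P.fockMap a + P.absorb R ⊚ P.fockMap b) ⊚ P.fockFlipX R s

theorem fockExt_comp_tmap_fockIncl {s : Fin (m + 2) → ℕ} (a : Hom (tens (P.X s) R) R)
    (b : Hom (tens (P.X s) R) (tens P.E₁ₙ R)) (α : Fin (m + 1) → ℕ) :
    P.fockExt s a b ⊚ tmap (P.X s) (P.fockIncl R α) =
      (P.fockIncl R α ⊚ tmap (P.X (expo α)) a +
        P.fockIncl R (α + Pi.single 0 1) ⊚ P.mulMap R (expo_add_single α) ⊚
          tmap (P.X (expo α)) b) ⊚ P.flip R := by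
  have h1 : P.fockMap a ⊚ P.fockIncl (tens (P.X s) R) α =
      P.fockIncl R α ⊚ tmap (P.X (expo α)) a := pull_comp_adj _ _ _ _ α
  have h2 : P.fockMap b ⊚ P.fockIncl (tens (P.X s) R) α =
      P.fockIncl (tens P.E₁ₙ R) α ⊚ tmap (P.X (expo α)) b := pull_comp_adj _ _ _ _ α
  have h3 : P.absorb R ⊚ P.fockIncl (tens P.E₁ₙ R) α =
      P.fockIncl R (α + Pi.single 0 1) ⊚ P.mulMap R (expo_add_single α) :=
    Hom.shift_incl _ _ _ _ _ _ α
  rw [fockExt, Hom.comp_assoc, fockFlipX_comp_tmap_fockIncl, ← Hom.comp_assoc, Hom.add_comp,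
    Hom.comp_assoc (P.absorb R), h1, h2, ← Hom.comp_assoc (P.absorb R), h3, Hom.comp_assoc]

theorem creation_comp_tmap_fockIncl (α : Fin (m + 1) → ℕ) :
    P.creation R ⊚ tmap P.E₁ₙ (P.fockIncl R α) = P.fockIncl R (α + Pi.single 0 1) ⊚
      P.mulMap R ((add_comm _ _).trans (expo_add_single α)) := by
  have := shift_comp_dist_comp_tmap_adj (F := fun α => tens (P.X (expo α)) R) P.E₁ₙ
    (G := fun α => tens (P.X (expo α)) R) (fun α => α + Pi.single 0 1) (add_left_injective _)
    (fun α => P.mulMap R ((add_comm _ _).trans (expo_add_single α))) 1 zero_le_one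
    (fun _ => P.norm_mulMap_le R _) α
  exact this

/-- The product of two operators `I_{F(E)} ⊗ (a₁ + b₁)` and `I_{F(E)} ⊗ (aₙ + bₙ)` is the left
creation operator as soon as the components of `(a₁ + b₁) (aₙ + bₙ)` in `H`, `E_{1n} ⊗ H` and
`E_{1n} ⊗ E_{1n} ⊗ H` are `0`, the multiplication and `0`. Normality of `R` makes the multiplication
maps unitary, and with them the flips. -/
theorem fockExt_comp_tmap_fockExt (hR : R.IsNormal) {s t : Fin (m + 2) → ℕ} (h : s + t = e₁ₙ m)
    {a₁ : Hom (tens (P.X s) R) R} {b₁ : Hom (tens (P.X s) R) (tens P.E₁ₙ R)}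
    {aₙ : Hom (tens (P.X t) R) R} {bₙ : Hom (tens (P.X t) R) (tens P.E₁ₙ R)}
    (h₀ : a₁ ⊚ tmap (P.X s) aₙ = 0)
    (h₁ : b₁ ⊚ tmap (P.X s) aₙ + tmap P.E₁ₙ a₁ ⊚ P.flip R ⊚ tmap (P.X s) bₙ = P.mulMap R h)
    (h₂ : tmap P.E₁ₙ b₁ ⊚ P.flip R ⊚ tmap (P.X s) bₙ = 0) :
    P.fockExt s a₁ b₁ ⊚ tmap (P.X s) (P.fockExt t aₙ bₙ) =
      P.creation R ⊚ P.mulMap (P.fock R) h := by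
  refine tens_tens_lpSum_hom_ext _ _ fun α => ?_
  change (P.fockExt s a₁ b₁ ⊚ tmap (P.X s) (P.fockExt t aₙ bₙ)) ⊚
      tmap (P.X s) (tmap (P.X t) (P.fockIncl R α)) =
    (P.creation R ⊚ P.mulMap (P.fock R) h) ⊚ tmap (P.X s) (tmap (P.X t) (P.fockIncl R α))
  -- the flip of `X s` past `E^α` commutes with operators on the right tensor factor
  have slide : ∀ {S S' S'' : HRep.{u, v} M} (f : Hom (tens (P.X s) S') S'') (g : Hom S S'),
      tmap (P.X (expo α)) f ⊚ P.flip S' ⊚ tmap (P.X s) (tmap (P.X (expo α)) g) =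
        tmap (P.X (expo α)) (f ⊚ tmap (P.X s) g) ⊚ P.flip S := fun f g => by
    rw [P.flip_natural, tmap_comp, Hom.comp_assoc]
  -- the flip of `X s` past `E^α ⊗ E_{1n}` is carried out in two steps
  have jump : ∀ {S : HRep.{u, v} M} (f : Hom (tens (P.X s) R) S),
      tmap (P.X (expo (α + Pi.single 0 1))) f ⊚ P.flip R ⊚
          tmap (P.X s) (P.mulMap R (expo_add_single α)) ⊚
            tmap (P.X s) (tmap (P.X (expo α)) bₙ) =
        P.mulMap S (expo_add_single α) ⊚
          tmap (P.X (expo α)) (tmap P.E₁ₙ f ⊚ P.flip R ⊚ tmap (P.X s) bₙ) ⊚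
            P.flip (tens (P.X t) R) := fun f => by
    rw [← Hom.comp_assoc (P.flip R), P.flip_comp_tmap_mulMap hR, Hom.comp_assoc, Hom.comp_assoc,
      P.flip_natural, ← Hom.comp_assoc (tmap _ f), ← P.mulMap_natural, Hom.comp_assoc,
      tmap_comp, tmap_comp]
    rfl
  have e1 : P.fockExt s a₁ b₁ ⊚ tmap (P.X s) (P.fockIncl R α) ⊚
      tmap (P.X s) (tmap (P.X (expo α)) aₙ) =
      P.fockIncl R (α + Pi.single 0 1) ⊚ P.mulMap R (expo_add_single α) ⊚
        tmap (P.X (expo α)) (b₁ ⊚ tmap (P.X s) aₙ) ⊚ P.flip (tens (P.X t) R) := by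
    rw [← Hom.comp_assoc, fockExt_comp_tmap_fockIncl, Hom.add_comp, Hom.add_comp]
    simp only [Hom.comp_assoc]
    rw [slide, slide, h₀, tmap_zero, Hom.zero_comp, Hom.comp_zero, Hom.zero_add]
  have e2 : P.fockExt s a₁ b₁ ⊚ tmap (P.X s) (P.fockIncl R (α + Pi.single 0 1)) ⊚
      tmap (P.X s) (P.mulMap R (expo_add_single α)) ⊚ tmap (P.X s) (tmap (P.X (expo α)) bₙ) =
      P.fockIncl R (α + Pi.single 0 1) ⊚ P.mulMap R (expo_add_single α) ⊚
        tmap (P.X (expo α)) (tmap P.E₁ₙ a₁ ⊚ P.flip R ⊚ tmap (P.X s) bₙ) ⊚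
          P.flip (tens (P.X t) R) := by
    rw [← Hom.comp_assoc, fockExt_comp_tmap_fockIncl, Hom.add_comp, Hom.add_comp]
    simp only [Hom.comp_assoc]
    rw [jump, jump, h₂, tmap_zero, Hom.zero_comp, Hom.comp_zero, Hom.comp_zero, Hom.comp_zero,
      Hom.add_zero]
  have e3 := congrArg (· ⊚ tmap (P.X s) (P.flip R)) (congrArg₂ (· + ·) e1 e2)
  simp only [← Hom.comp_add, ← Hom.add_comp, ← tmap_add, h₁] at e3
  rw [Hom.comp_assoc, ← tmap_comp, fockExt_comp_tmap_fockIncl, tmap_comp, tmap_add, tmap_comp,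
    tmap_comp, tmap_comp, ← Hom.comp_assoc]
  refine e3.trans ?_
  simp only [Hom.comp_assoc]
  rw [P.mulMap_comp_tmap_mulMap_comp_flip_comp_flip hR h _
    ((add_comm _ _).trans (expo_add_single α)), P.mulMap_natural,
    ← Hom.comp_assoc, ← creation_comp_tmap_fockIncl]
  rfl

end ProductSystem
end FockSpace

/-! ### The operators defining `U₁` and `Uₙ` -/

section Colligation

variable {M : Type u} [CStarAlgebra M] [PartialOrder M] [StarOrderedRing M]

namespace ProductSystem

section Identities

variable {n : ℕ} (P : ProductSystem.{u, v} M n) {s t c : Fin n → ℕ}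

theorem flip_comp_tmap_mulMap_swap (R : HRep.{u, w} M) (h : s + t = c) (h' : t + s = c) :
    P.flip R ⊚ tmap (P.X s) (P.mulMap R h') = P.mulMap (tens (P.X s) R) h := by
  rw [flip, Hom.comp_assoc,
    ← P.mulMap_assoc R h ((congrArg (· + s) h.symm).trans (by rw [← h', add_assoc])) h' rfl,
    ← Hom.comp_assoc, mulMap_adj_comp, Hom.id_comp]

variable {K₁ Kₙ ℰ₁ ℰ₂ : HRep.{u, v} M}
  (U : Hom (K₁.sum ((tens (P.X t) Kₙ).sum ℰ₂)) (Kₙ.sum ((tens (P.X s) K₁).sum ℰ₁)))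
  (u₂ : Hom ℰ₂ (tens (P.X t) ℰ₁))

/-- The operator `a₁`: the adjoint of the corner `(I ⊗ U) P₁` of `U₁`. Here `s`, `t`, `c` are the
exponents of `E₁`, `Eₙ`, `E_{1n}`, and `K₁`, `Kₙ` are the two defect spaces. -/
def coeffA₁ : Hom (tens (P.X s) (Kₙ.sum ((tens (P.X s) K₁).sum ℰ₁)))
    (Kₙ.sum ((tens (P.X s) K₁).sum ℰ₁)) :=
  Hom.inr _ _ ⊚ Hom.inl _ _ ⊚ tmap (P.X s) (Hom.fst _ _ ⊚ U†)

/-- The operator `b₁ = (I ⊗ i₂) j₂'* (I ⊗ U*)`, written as the sum over the two summands of the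
domain of `j₂'`. -/
def coeffB₁ (h : s + t = c) : Hom (tens (P.X s) (Kₙ.sum ((tens (P.X s) K₁).sum ℰ₁)))
    (tens (P.X c) (Kₙ.sum ((tens (P.X s) K₁).sum ℰ₁))) :=
  tmap (P.X c) (Hom.inl _ _) ⊚ P.mulMap Kₙ h ⊚
      tmap (P.X s) (Hom.fst _ _ ⊚ Hom.snd _ _ ⊚ U†) +
    tmap (P.X c) (Hom.inr _ _ ⊚ Hom.inr _ _) ⊚ P.mulMap ℰ₁ h ⊚
      tmap (P.X s) (u₂ ⊚ Hom.snd _ _ ⊚ Hom.snd _ _ ⊚ U†)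

/-- The operator `aₙ`: the adjoint of the corner `(I ⊕ u₂) P₂ U*` of `Uₙ`. -/
def coeffAₙ : Hom (tens (P.X t) (Kₙ.sum ((tens (P.X s) K₁).sum ℰ₁)))
    (Kₙ.sum ((tens (P.X s) K₁).sum ℰ₁)) :=
  U ⊚ (Hom.inr _ _ ⊚ Hom.inl _ _ ⊚ tmap (P.X t) (Hom.fst _ _) +
    Hom.inr _ _ ⊚ Hom.inr _ _ ⊚ u₂† ⊚ tmap (P.X t) (Hom.snd _ _ ⊚ Hom.snd _ _))

/-- The operator `bₙ = (I ⊗ U i₁) i₁'*`. -/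
def coeffBₙ (h' : t + s = c) : Hom (tens (P.X t) (Kₙ.sum ((tens (P.X s) K₁).sum ℰ₁)))
    (tens (P.X c) (Kₙ.sum ((tens (P.X s) K₁).sum ℰ₁))) :=
  tmap (P.X c) (U ⊚ Hom.inl _ _) ⊚ P.mulMap K₁ h' ⊚ tmap (P.X t) (Hom.fst _ _ ⊚ Hom.snd _ _)

theorem coeffA₁_eq_adj : P.coeffA₁ U = (tmap (P.X s) U ⊚ tmap (P.X s) (Hom.inl _ _) ⊚
    Hom.fst _ _ ⊚ Hom.snd _ _)† := by
  simp only [coeffA₁, Hom.adj_comp, tmap_adj, Hom.inl_adj, Hom.fst_adj, Hom.snd_adj,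
    Hom.comp_assoc, tmap_comp]

theorem coeffB₁_eq_adj (h : s + t = c) : P.coeffB₁ U u₂ h =
    tmap (P.X c) (Hom.inl _ _ ⊚ Hom.fst _ _ + Hom.inr _ _ ⊚ Hom.inr _ _ ⊚ Hom.snd _ _)†† ⊚
      (tmap (P.X s) U ⊚
        (tmap (P.X s) (Hom.inr _ _ ⊚ Hom.inl _ _) ⊚ (P.mulMap Kₙ h)† ⊚
            tmap (P.X c) (Hom.fst _ _) +
          tmap (P.X s) (Hom.inr _ _ ⊚ Hom.inr _ _ ⊚ u₂†) ⊚ (P.mulMap ℰ₁ h)† ⊚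
            tmap (P.X c) (Hom.snd _ _)))† := by
  rw [Hom.adj_adj]
  simp only [coeffB₁, Hom.adj_comp, Hom.adj_add, tmap_adj, Hom.inl_adj, Hom.inr_adj, Hom.fst_adj,
    Hom.snd_adj, Hom.comp_assoc, Hom.adj_adj, Hom.comp_add]
  simp only [← Hom.comp_assoc, ← tmap_comp]
  simp only [Hom.comp_assoc, Hom.add_comp, Hom.fst_comp_inl, Hom.fst_comp_inr, Hom.snd_comp_inl,
    Hom.snd_comp_inr, Hom.comp_zero, Hom.comp_id, Hom.add_zero, Hom.zero_add]

theorem coeffAₙ_eq_adj : P.coeffAₙ U u₂ =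
    ((tmap (P.X t) (Hom.inl _ _) ⊚ Hom.fst _ _ ⊚ Hom.snd _ _ +
      tmap (P.X t) (Hom.inr _ _ ⊚ Hom.inr _ _) ⊚ u₂ ⊚ Hom.snd _ _ ⊚ Hom.snd _ _) ⊚ U†)† := by
  simp only [coeffAₙ, Hom.adj_comp, Hom.adj_add, tmap_adj, Hom.inl_adj, Hom.inr_adj, Hom.fst_adj,
    Hom.snd_adj, Hom.comp_assoc, Hom.adj_adj]

theorem coeffBₙ_eq_adj (h' : t + s = c) : P.coeffBₙ U h' =
    tmap (P.X c) ((Hom.inl _ _)† ⊚ U†)† ⊚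
      (tmap (P.X t) (Hom.inr _ _ ⊚ Hom.inl _ _) ⊚ (P.mulMap K₁ h')†)† := by
  simp only [coeffBₙ, Hom.adj_comp, tmap_adj, Hom.inl_adj, Hom.inr_adj, Hom.fst_adj,
    Hom.adj_adj]

variable {U u₂}

/-- The range of `P₁` is `E₁ ⊗ K₁`, which `I ⊗ P₂` annihilates. -/
theorem coeffA₁_comp_coeffAₙ (hU : U.IsUnitary) :
    P.coeffA₁ U ⊚ tmap (P.X s) (P.coeffAₙ U u₂) = 0 := by
  rw [coeffA₁, coeffAₙ, Hom.comp_assoc, Hom.comp_assoc, ← tmap_comp, Hom.comp_assoc,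
    ← Hom.comp_assoc U†, hU.1, Hom.id_comp, Hom.comp_add, Hom.fst_comp_inr_assoc,
    Hom.fst_comp_inr_assoc, Hom.add_zero, tmap_zero, Hom.comp_zero, Hom.comp_zero]

/-- This product acts on the summands over `Kₙ` and `ℰ₁`. -/
theorem coeffB₁_comp_coeffAₙ (hU : U.IsUnitary) (hu₂ : u₂.IsUnitary) (h : s + t = c) :
    P.coeffB₁ U u₂ h ⊚ tmap (P.X s) (P.coeffAₙ U u₂) =
      tmap (P.X c) (Hom.inl _ _ ⊚ Hom.fst _ _ +
        Hom.inr _ _ ⊚ Hom.inr _ _ ⊚ Hom.snd _ _ ⊚ Hom.snd _ _) ⊚ P.mulMap _ h := by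
  have h1 : (u₂ ⊚ Hom.snd _ _ ⊚ Hom.snd _ _ ⊚ U†) ⊚ P.coeffAₙ U u₂ =
      tmap (P.X t) (Hom.snd _ _ ⊚ Hom.snd _ _) := by
    rw [coeffAₙ]
    simp only [Hom.comp_assoc]
    rw [← Hom.comp_assoc U†, hU.1, Hom.id_comp, Hom.comp_add, Hom.snd_comp_inr_assoc,
      Hom.snd_comp_inr_assoc, Hom.comp_add, Hom.snd_comp_inl_assoc, Hom.snd_comp_inr_assoc,
      Hom.zero_add, ← Hom.comp_assoc u₂, hu₂.2, Hom.id_comp]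
  have h2 : (Hom.fst _ _ ⊚ Hom.snd _ _ ⊚ U†) ⊚ P.coeffAₙ U u₂ =
      tmap (P.X t) (Hom.fst _ _) := by
    rw [coeffAₙ]
    simp only [Hom.comp_assoc]
    rw [← Hom.comp_assoc U†, hU.1, Hom.id_comp, Hom.comp_add, Hom.snd_comp_inr_assoc,
      Hom.snd_comp_inr_assoc, Hom.comp_add, Hom.fst_comp_inl_assoc, Hom.fst_comp_inr_assoc,
      Hom.add_zero]
  rw [coeffB₁, Hom.add_comp]
  simp only [Hom.comp_assoc, ← tmap_comp]
  simp only [Hom.comp_assoc] at h1 h2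
  rw [h1, h2, P.mulMap_natural, P.mulMap_natural, ← Hom.comp_assoc, ← Hom.comp_assoc, ← tmap_comp,
    ← tmap_comp, ← Hom.add_comp, ← tmap_add]
  rfl

/-- This product acts on the summand over `E₁ ⊗ K₁`. -/
theorem coeffA₁_flip_coeffBₙ (hU : U.IsUnitary) (h : s + t = c) (h' : t + s = c) :
    tmap (P.X c) (P.coeffA₁ U) ⊚ P.flip _ ⊚ tmap (P.X s) (P.coeffBₙ U h') =
      tmap (P.X c) (Hom.inr _ _ ⊚ Hom.inl _ _ ⊚ Hom.fst _ _ ⊚ Hom.snd _ _) ⊚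
        P.mulMap _ h := by
  rw [coeffA₁, coeffBₙ, tmap_comp (P.X s) (tmap _ _), ← Hom.comp_assoc (P.flip _), P.flip_natural,
    Hom.comp_assoc, ← Hom.comp_assoc (tmap (P.X c) _), ← tmap_comp, Hom.comp_assoc,
    Hom.comp_assoc, ← tmap_comp, Hom.comp_assoc, ← Hom.comp_assoc U†, hU.1, Hom.id_comp,
    Hom.fst_comp_inl, tmap_id, Hom.comp_id, tmap_comp (P.X s), ← Hom.comp_assoc (P.flip _),
    P.flip_comp_tmap_mulMap_swap _ h h', P.mulMap_natural, ← Hom.comp_assoc, ← tmap_comp]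
  rfl

/-- The ranges of `I ⊗ i₁` and of `j₂'` are orthogonal. -/
theorem coeffB₁_flip_coeffBₙ (hU : U.IsUnitary) (h : s + t = c) (h' : t + s = c) :
    tmap (P.X c) (P.coeffB₁ U u₂ h) ⊚ P.flip _ ⊚ tmap (P.X s) (P.coeffBₙ U h') = 0 := by
  have h1 : P.coeffB₁ U u₂ h ⊚ tmap (P.X s) (U ⊚ Hom.inl _ _) = 0 := by
    rw [coeffB₁, Hom.add_comp]
    simp only [Hom.comp_assoc, ← tmap_comp]
    rw [← Hom.comp_assoc U†, hU.1, Hom.id_comp, Hom.snd_comp_inl, Hom.comp_zero, Hom.comp_zero,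
      Hom.comp_zero, tmap_zero, tmap_zero]
    simp only [Hom.comp_zero, Hom.add_zero]
  rw [coeffBₙ, tmap_comp (P.X s), ← Hom.comp_assoc (P.flip _), P.flip_natural, Hom.comp_assoc,
    ← Hom.comp_assoc, ← tmap_comp, h1, tmap_zero, Hom.zero_comp]

theorem coeff_sum (hU : U.IsUnitary) (hu₂ : u₂.IsUnitary) (h : s + t = c) (h' : t + s = c) :
    P.coeffB₁ U u₂ h ⊚ tmap (P.X s) (P.coeffAₙ U u₂) +
      tmap (P.X c) (P.coeffA₁ U) ⊚ P.flip _ ⊚ tmap (P.X s) (P.coeffBₙ U h') =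
      P.mulMap _ h := by
  have h1 : (Hom.inl _ _ ⊚ Hom.fst _ _ + Hom.inr _ _ ⊚ Hom.inr _ _ ⊚ Hom.snd _ _ ⊚ Hom.snd _ _) +
      Hom.inr _ _ ⊚ Hom.inl _ _ ⊚ Hom.fst _ _ ⊚ Hom.snd _ _ =
      Hom.id (Kₙ.sum ((tens (P.X s) K₁).sum ℰ₁)) := by
    rw [Hom.add_assoc, ← Hom.comp_add, Hom.add_comm (Hom.inr _ _ ⊚ _), ← Hom.comp_assoc,
      ← Hom.comp_assoc (Hom.inr _ _), ← Hom.add_comp, Hom.inl_fst_add_inr_snd, Hom.id_comp,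
      Hom.inl_fst_add_inr_snd]
  rw [P.coeffB₁_comp_coeffAₙ hU hu₂, P.coeffA₁_flip_coeffBₙ hU h h', ← Hom.add_comp, ← tmap_add,
    h1, tmap_id, Hom.id_comp]

end Identities

variable {m : ℕ} (P : ProductSystem.{u, v} M (m + 2))

theorem transfer_block (i : Fin (m + 2)) {R R' : HRep.{u, v} M} (A : Hom R (tens (P.fiber i) R))
    (B : Hom (tens P.E₁ₙ R') (tens (P.fiber i) R)) (C : Hom R R') :
    P.transfer i (Hom.block A B C 0) =
      P.fockExt (Pi.single i 1) A† (tmap P.E₁ₙ C† ⊚ B†) := by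
  rw [transfer, Hom.block_fst_inl, Hom.block_fst_inr, Hom.block_snd_inl]
  rfl

theorem fockExt_coeff {s t : Fin (m + 2) → ℕ} (h : s + t = e₁ₙ m) (h' : t + s = e₁ₙ m)
    {K₁ Kₙ ℰ₁ ℰ₂ : HRep.{u, v} M}
    (hn : (Kₙ.sum ((tens (P.X s) K₁).sum ℰ₁)).IsNormal)
    {U : Hom (K₁.sum ((tens (P.X t) Kₙ).sum ℰ₂)) (Kₙ.sum ((tens (P.X s) K₁).sum ℰ₁))}
    {u₂ : Hom ℰ₂ (tens (P.X t) ℰ₁)} (hU : U.IsUnitary) (hu₂ : u₂.IsUnitary) :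
    P.fockExt s (P.coeffA₁ U) (P.coeffB₁ U u₂ h) ⊚
        tmap (P.X s) (P.fockExt t (P.coeffAₙ U u₂) (P.coeffBₙ U h')) =
      P.creation _ ⊚ P.mulMap (P.fock _) h :=
  P.fockExt_comp_tmap_fockExt hn h (P.coeffA₁_comp_coeffAₙ hU) (P.coeff_sum hU hu₂ h h')
    (P.coeffB₁_flip_coeffBₙ hU h h')

end ProductSystem

namespace PSRep

variable {m : ℕ} {P : ProductSystem.{u, v} M (m + 2)} {R : HRep.{u, v} M} (τ : PSRep P R)
variable {ℰ₁ ℰ₂ : HRep.{u, v} M} (U : Hom (τ.domU ℰ₂) (τ.bigD ℰ₁)) (u₂ : Hom ℰ₂ (tens P.Eₙ ℰ₁))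

theorem transfer_U₁ : P.transfer 0 (τ.U₁ U u₂) =
    P.fockExt (Pi.single 0 1) (P.coeffA₁ U) (P.coeffB₁ U u₂ rfl) := by
  refine (P.transfer_block 0 _ _ _).trans (congrArg₂ (P.fockExt (Pi.single 0 1)) ?_ ?_)
  · exact (P.coeffA₁_eq_adj (K₁ := τ.defectSpace₁) (Kₙ := τ.defectSpaceₙ) U).symm
  · exact (P.coeffB₁_eq_adj (K₁ := τ.defectSpace₁) (Kₙ := τ.defectSpaceₙ) U u₂ rfl).symm

theorem transfer_Uₙ : P.transfer (Fin.last (m + 1)) (τ.Uₙ U u₂) =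
    P.fockExt (Pi.single (Fin.last (m + 1)) 1) (P.coeffAₙ U u₂)
      (P.coeffBₙ U (add_comm _ _)) := by
  refine (P.transfer_block (Fin.last (m + 1)) _ _ _).trans
    (congrArg₂ (P.fockExt (Pi.single (Fin.last (m + 1)) 1)) ?_ ?_)
  · exact (P.coeffAₙ_eq_adj (K₁ := τ.defectSpace₁) (Kₙ := τ.defectSpaceₙ) U u₂).symm
  · exact (P.coeffBₙ_eq_adj (K₁ := τ.defectSpace₁) (Kₙ := τ.defectSpaceₙ) U _).symm

theorem isNormal_bigD (hℰ₁ : ℰ₁.IsNormal) : (τ.bigD ℰ₁).IsNormal :=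
  (isNormal_rangeRep _ τ.normal).sum ((isNormal_tens _ (isNormal_rangeRep _ τ.normal)).sum hℰ₁)

end PSRep

end Colligation

end CorrDil

end

theorem mainTheorem6 {M : Type u} [CStarAlgebra M] [PartialOrder M] [StarOrderedRing M]
    [WStarAlgebra M] (m : ℕ) (P : CorrDil.ProductSystem.{u, v} M (m + 2))
    (H : CorrDil.HRep.{u, v} M) (τ : CorrDil.PSRep P H) (hτ : τ.MemClass)
    (ℰ₁ ℰ₂ : CorrDil.HRep.{u, v} M) (hℰ₁ : ℰ₁.IsNormal) (hℰ₂ : ℰ₂.IsNormal)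
    (u₂ : CorrDil.Hom ℰ₂ (CorrDil.tens P.Eₙ ℰ₁)) (hu₂ : u₂.IsUnitary)
    (U : CorrDil.Hom (τ.domU ℰ₂) (τ.bigD ℰ₁)) (hU : U.IsUnitary) (hU₀ : τ.ExtendsU₀ U) :
    P.transfer 0 (τ.U₁ U u₂) ⊚
        CorrDil.tmap P.E₁ (P.transfer (Fin.last (m + 1)) (τ.Uₙ U u₂)) =
      P.creation (τ.bigD ℰ₁) ⊚ P.mul₁ₙ (P.fock (τ.bigD ℰ₁)) := by
  rw [τ.transfer_U₁, τ.transfer_Uₙ]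
  exact P.fockExt_coeff (K₁ := τ.defectSpace₁) (Kₙ := τ.defectSpaceₙ) rfl (add_comm _ _)
    (τ.isNormal_bigD hℰ₁) hU hu₂
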